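/- Let $M$ be a closed (compact, without boundary), orientable smooth $3$-manifold with a smooth, coorientable codimension-one foliation $\mathcal F$, and let $\pi:(M,\mathcal F)\to\mathbb{CP}^1$ be a foliated branched cover. That is, $\pi$ is a smooth map such that - at every point $p$ outside the critical set $C=\{p : d\pi_p \text{ is not surjective}\}$, the restriction of $d\pi_p$ to $T_p\mathcal F$ is injective (so $\pi$ is a local diffeomorphism on the leaves away from $C$); - around every $x\in C$ there are smooth coordinates $(z,t)\in\mathbb C\times\mathbb R$ on $M$, with $x$ at the origin, in which $\mathcal F$ is given by the level sets of $t$, and a holomorphic chart of $\mathbb{CP}^1$ around $\pi(x)$, in which $\pi(z,t)=\gamma(t)+z^2$ for a smooth curve $\gamma$ in $\mathbb C$. (In particular $C$ is a closed $1$-dimensional submanifold transverse to $\mathcal F$.) Let $D\subset\mathbb C$ be the closed unit disk and let $g_t:D\to M$, $t\in(0,1]$, be a smooth family (smooth in $(t,x)\in(0,1]\times D$) of immersions such that: - for every $t\in(0,1]$ the image of $g_t$ is contained in a leaf $L_t$ of $\mathcal F$; - for every $x\in D$ the curve $t\mapsto g_t(x)$, $t\in(0,1]$, is transverse to $\mathcal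 F$; - as $t\to 0$, the restrictions $g_t|_{\partial D}:\partial D\to M$ converge in the $C^0$-topology to a smooth immersion $g_\partial:\partial D\to M$ whose image is contained in a leaf $L$ of $\mathcal F$. Then there exists a continuous map $g:D\to L$ (for the leaf topology on $L$) with $g|_{\partial D}=g_\partial$. -/

import Mathlib

open Set Filter Topology Metric
open scoped Manifold ContDiff

/-! ## The complex projective line -/

/-- The complex projective line: the space of complex lines through the origin of `ℂ²`. -/
def CP1 : Type := Projectivization ℂ (Fin 2 → ℂ)

namespace CP1

/-- The quotient topology from `ℂ² ∖ {0}`. -/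
instance : TopologicalSpace CP1 :=
  inferInstanceAs (TopologicalSpace (Quotient (projectivizationSetoid ℂ (Fin 2 → ℂ))))

/-- The line spanned by a nonzero vector. -/
noncomputable def mk (v : {v : Fin 2 → ℂ // v ≠ 0}) : CP1 := Projectivization.mk' ℂ v

theorem isQuotientMap_mk : IsQuotientMap mk := isQuotientMap_quot_mk

theorem mk_eq_mk_iff (v w : {v : Fin 2 → ℂ // v ≠ 0}) :
    mk v = mk w ↔ ∃ a : ℂ, a • w.1 = v.1 :=
  Projectivization.mk_eq_mk_iff' ℂ v.1 w.1 v.2 w.2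

theorem mk_surjective : Function.Surjective mk := Quot.mk_surjective

theorem scalar_ne_zero {v w : {v : Fin 2 → ℂ // v ≠ 0}} {a : ℂ} (h : v.1 = a • w.1) : a ≠ 0 := by
  rintro rfl
  exact v.2 (by simpa using h)

/-- The affine coordinate `[v₀ : v₁] ↦ v_{1-i} / v_i`, used where `v_i ≠ 0`. -/
noncomputable def affineCoord (i : Fin 2) : CP1 → ℂ :=
  Projectivization.lift (fun v => v.1 i.rev / v.1 i) (by
    intro v w a h
    have ha := scalar_ne_zero h
    simp only [h, Pi.smul_apply, smul_eq_mul]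
    exact mul_div_mul_left _ _ ha)

@[simp] theorem affineCoord_mk (i : Fin 2) (v : {v : Fin 2 → ℂ // v ≠ 0}) :
    affineCoord i (mk v) = v.1 i.rev / v.1 i := rfl

/-- The set of lines `[v₀ : v₁]` with `v_i ≠ 0`. -/
def affineSource (i : Fin 2) : Set CP1 := {p | ∃ v, mk v = p ∧ v.1 i ≠ 0}

@[simp] theorem mk_mem_affineSource (i : Fin 2) (v : {v : Fin 2 → ℂ // v ≠ 0}) :
    mk v ∈ affineSource i ↔ v.1 i ≠ 0 := by
  constructor
  · rintro ⟨w, hw, hwi⟩ hv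
    obtain ⟨a, ha⟩ := (mk_eq_mk_iff w v).1 hw
    apply hwi
    rw [← ha]
    simp [hv]
  · intro h
    exact ⟨v, rfl, h⟩

/-- The vector with `i`-th entry `1` and other entry `z`. -/
noncomputable def affineVec (i : Fin 2) (z : ℂ) : {v : Fin 2 → ℂ // v ≠ 0} :=
  ⟨fun k => if k = i then 1 else z, fun h => by simpa using congrFun h i⟩

theorem affineVec_self (i : Fin 2) (z : ℂ) : (affineVec i z).1 i = 1 := by simp [affineVec]

theorem affineVec_rev (i : Fin 2) (z : ℂ) : (affineVec i z).1 i.rev = z := by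
  fin_cases i <;> simp [affineVec]

/-- The affine chart `[v₀ : v₁] ↦ v_{1-i} / v_i` of the projective line. -/
noncomputable def affineChart (i : Fin 2) : OpenPartialHomeomorph CP1 ℂ where
  toFun := affineCoord i
  invFun z := mk (affineVec i z)
  source := affineSource i
  target := univ
  map_source' _ _ := mem_univ _
  map_target' z _ := by simp [affineVec_self]
  left_inv' p hp := by
    obtain ⟨v, rfl, hv⟩ := hp
    rw [affineCoord_mk, mk_eq_mk_iff]
    refine ⟨(v.1 i)⁻¹, ?_⟩
    funext k
    have hk : k = i ∨ k = i.rev := by fin_cases i <;> fin_cases k <;> simp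
    rcases hk with rfl | rfl
    · rw [affineVec_self]; simp [hv]
    · rw [affineVec_rev]; simp [div_eq_inv_mul]
  right_inv' z _ := by simp [affineVec_self, affineVec_rev]
  open_source := by
    rw [← isQuotientMap_mk.isOpen_preimage]
    have : mk ⁻¹' affineSource i = {v | v.1 i ≠ 0} := by ext v; simp
    rw [this]
    exact isOpen_ne_fun ((continuous_apply i).comp continuous_subtype_val) continuous_const
  open_target := isOpen_univ
  continuousOn_toFun := by
    have ho : IsOpen (affineSource i) := by
      rw [← isQuotientMap_mk.isOpen_preimage]
      have : mk ⁻¹' affineSource i = {v | v.1 i ≠ 0} := by ext v; simp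
      rw [this]
      exact isOpen_ne_fun ((continuous_apply i).comp continuous_subtype_val) continuous_const
    rw [isQuotientMap_mk.continuousOn_isOpen_iff ho]
    have h : ContinuousOn (fun v : {v : Fin 2 → ℂ // v ≠ 0} => v.1 i.rev / v.1 i)
        (mk ⁻¹' affineSource i) := by
      refine ContinuousOn.div ((continuous_apply i.rev).comp continuous_subtype_val).continuousOn
        ((continuous_apply i).comp continuous_subtype_val).continuousOn ?_
      intro v hv
      simpa using hv
    exact h
  continuousOn_invFun := by
    refine (isQuotientMap_mk.continuous.comp (Continuous.subtype_mk ?_ _)).continuousOn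
    refine continuous_pi fun k => ?_
    by_cases h : k = i <;> simp only [h, if_true, if_false] <;> fun_prop

open Classical in
/-- The atlas of `CP1` consists of its two affine charts. -/
noncomputable instance : ChartedSpace ℂ CP1 where
  atlas := range affineChart
  chartAt p := if p ∈ affineSource 0 then affineChart 0 else affineChart 1
  mem_chart_source p := by
    split_ifs with h
    · exact h
    · obtain ⟨v, rfl⟩ := mk_surjective p
      rw [mk_mem_affineSource, not_not] at h
      refine (mk_mem_affineSource 1 v).2 fun h1 => v.2 ?_
      funext k
      fin_cases k
      · exact h
      · exact h1
  chart_mem_atlas p := by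
    split_ifs
    · exact mem_range_self 0
    · exact mem_range_self 1

theorem contDiffOn_transition (𝕜 : Type) [NontriviallyNormedField 𝕜] [NormedAlgebra 𝕜 ℂ]
    (i j : Fin 2) :
    ContDiffOn 𝕜 ω ((affineChart i).symm.trans (affineChart j))
      ((affineChart i).symm.trans (affineChart j)).source := by
  by_cases hij : j = i
  · subst hij
    refine contDiffOn_id.congr fun z hz => ?_
    exact (affineChart j).right_inv (mem_univ z)
  · have hj : j = i.rev := by
      fin_cases i <;> fin_cases j <;> simp_all
    subst hj
    have hsrc : ((affineChart i).symm.trans (affineChart i.rev)).source ⊆ {z | z ≠ 0} := by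
      intro z hz
      have h : mk (affineVec i z) ∈ affineSource i.rev := hz.2
      rw [mk_mem_affineSource, affineVec_rev] at h
      exact h
    have h : ContDiffOn 𝕜 ω (fun z : ℂ => z⁻¹)
        ((affineChart i).symm.trans (affineChart i.rev)).source :=
      fun z hz => (contDiffAt_inv 𝕜 (hsrc hz)).contDiffWithinAt
    refine h.congr fun z hz => ?_
    change affineCoord i.rev (mk (affineVec i z)) = z⁻¹
    rw [affineCoord_mk, affineVec_rev, Fin.rev_rev, affineVec_self, one_div]

/-- The projective line is a complex manifold. -/
instance : IsManifold 𝓘(ℂ, ℂ) ω CP1 := by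
  refine isManifold_of_contDiffOn _ _ _ ?_
  rintro _ _ ⟨i, rfl⟩ ⟨j, rfl⟩
  simpa using contDiffOn_transition ℂ i j

/-- The underlying real manifold structure. -/
instance : IsManifold 𝓘(ℝ, ℂ) ω CP1 := by
  refine isManifold_of_contDiffOn _ _ _ ?_
  rintro _ _ ⟨i, rfl⟩ ⟨j, rfl⟩
  simpa using contDiffOn_transition ℝ i j

end CP1

/-! ## Foliated three-manifolds -/

/-- Real three-space, the model of our three-manifolds. -/
abbrev E3 : Type := EuclideanSpace ℝ (Fin 3)

/-- A smooth three-manifold is orientable if it is covered by charts of its smooth structure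
whose changes of coordinates have positive Jacobian determinant. -/
def IsOrientable3 (M : Type*) [TopologicalSpace M] [ChartedSpace E3 M] : Prop :=
  ∃ A ⊆ IsManifold.maximalAtlas (𝓡 3) ∞ M,
    (∀ p : M, ∃ e ∈ A, p ∈ e.source) ∧
    ∀ e ∈ A, ∀ e' ∈ A, ∀ x ∈ (e.symm.trans e').source,
      0 < (fderiv ℝ (e.symm.trans e') x).det

section Foliations

variable {M : Type*} [TopologicalSpace M] [ChartedSpace E3 M]

/-- Near every common point of the two charts, the last coordinates (the transverse ones) have the
same level sets; so the last coordinate of either chart is locally a function of the last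
coordinate of the other one. -/
def TransverselyCompatible (e e' : OpenPartialHomeomorph M E3) : Prop :=
  ∀ p ∈ e.source ∩ e'.source, ∃ U ∈ 𝓝 p, ∀ q ∈ U, ∀ r ∈ U, (e q 2 = e r 2 ↔ e' q 2 = e' r 2)

/-- Near every common point of the two charts, the last coordinate of one of them is a strictly
increasing function of the last coordinate of the other one. -/
def PositivelyCompatible (e e' : OpenPartialHomeomorph M E3) : Prop :=
  ∀ p ∈ e.source ∩ e'.source, ∃ U ∈ 𝓝 p, ∀ q ∈ U, ∀ r ∈ U, (e q 2 < e r 2 ↔ e' q 2 < e' r 2)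

variable (M) in
/-- A smooth codimension-one foliation of a three-manifold, given by an atlas of smooth foliated
charts. In a foliated chart with coordinates `(x, y, t)`, the plaques are the level sets of `t`.
As the changes of coordinates are smooth, so are the induced changes of the coordinate `t`. -/
structure CodimOneFoliation where
  /-- the foliated charts of the atlas -/
  charts : Set (OpenPartialHomeomorph M E3)
  charts_subset : charts ⊆ IsManifold.maximalAtlas (𝓡 3) ∞ M
  covers : ∀ p : M, ∃ e ∈ charts, p ∈ e.source
  compatible : ∀ e ∈ charts, ∀ e' ∈ charts, TransverselyCompatible e e'

namespace CodimOneFoliation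

variable (F : CodimOneFoliation M)

/-- A smooth chart of `M` in which the foliation is given by the level sets of the last
coordinate. -/
def IsFoliatedChart (e : OpenPartialHomeomorph M E3) : Prop :=
  e ∈ IsManifold.maximalAtlas (𝓡 3) ∞ M ∧ ∀ e' ∈ F.charts, TransverselyCompatible e e'

/-- A foliation is coorientable if it is covered by foliated charts whose changes of coordinates
preserve the direction of the transverse coordinate. -/
def IsCoorientable : Prop :=
  ∃ A : Set (OpenPartialHomeomorph M E3), (∀ e ∈ A, F.IsFoliatedChart e) ∧
    (∀ p : M, ∃ e ∈ A, p ∈ e.source) ∧ ∀ e ∈ A, ∀ e' ∈ A, PositivelyCompatible e e'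

/-- The leaf topology on `M`: it is generated by the relatively open subsets of the plaques. -/
@[reducible] def leafTopology : TopologicalSpace M :=
  TopologicalSpace.generateFrom
    {P | ∃ e ∈ F.charts, ∃ U : Set M, IsOpen U ∧ ∃ c : ℝ, P = {p ∈ e.source ∩ U | e p 2 = c}}

/-- The leaves of the foliation are the path components of the leaf topology. -/
def IsLeaf (L : Set M) : Prop := ∃ p : M, L = @pathComponent M F.leafTopology p

/-- The tangent plane of the foliation at `p`: the kernel of the differential of the transverse
coordinate of any foliated chart of the atlas around `p`. -/
def tangentPlane (p : M) : Submodule ℝ (TangentSpace (𝓡 3) p) where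
  carrier := {v | ∀ e ∈ F.charts, p ∈ e.source →
    mfderiv (𝓡 3) 𝓘(ℝ, ℝ) (fun q : M => e q 2) p v = 0}
  add_mem' hv hw e he hp := by rw [map_add, hv e he hp, hw e he hp, add_zero]
  zero_mem' e he hp := map_zero _
  smul_mem' a v hv e he hp := by rw [map_smul, hv e he hp, smul_zero]

end CodimOneFoliation

/-! ## Foliated branched covers -/

/-- The critical points of a map to the projective line: the points where its differential is
not surjective. -/
def criticalSet (π : M → CP1) : Set M :=
  {p | ¬ Function.Surjective (mfderiv (𝓡 3) 𝓘(ℝ, ℂ) π p)}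

/-- The complex coordinate `z = x + i y` on the plaques of a chart with coordinates
`(x, y, t)`. -/
def plaqueCoord (e : OpenPartialHomeomorph M E3) (p : M) : ℂ := ⟨e p 0, e p 1⟩

/-- A foliated branched cover. Away from the critical points, it is a local diffeomorphism on the
leaves; around a critical point there are a foliated chart `(z, t)` of `M` and a holomorphic chart
of the projective line in which the map is `(z, t) ↦ γ(t) + z²` for a smooth curve `γ`.
By this local form the critical set is a closed one-dimensional submanifold, given by `z = 0`
in such a chart, and it is transverse to the foliation. -/
structure IsFoliatedBranchedCover (F : CodimOneFoliation M) (π : M → CP1) : Prop where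
  smooth : ContMDiff (𝓡 3) 𝓘(ℝ, ℂ) ∞ π
  leafwise_regular : ∀ p ∉ criticalSet π, ∀ v ∈ F.tangentPlane p,
    mfderiv (𝓡 3) 𝓘(ℝ, ℂ) π p v = 0 → v = 0
  local_model : ∀ x ∈ criticalSet π,
    ∃ e : OpenPartialHomeomorph M E3, ∃ ψ ∈ IsManifold.maximalAtlas 𝓘(ℂ, ℂ) ω CP1,
    ∃ γ : ℝ → ℂ,
      F.IsFoliatedChart e ∧ x ∈ e.source ∧ e x = 0 ∧ MapsTo π e.source ψ.source ∧
      ContDiff ℝ ∞ γ ∧ ∀ p ∈ e.source, ψ (π p) = γ (e p 2) + plaqueCoord e p ^ 2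

/-! ## Families of leafwise immersed disks -/

/-- A smooth family `g t`, for `t ∈ (0, 1]`, of immersions of the closed unit disk into leaves of
the foliation, such that each curve `t ↦ g t x` is transverse to the foliation. (Only the values
`g t x` with `t ∈ (0, 1]` and `‖x‖ ≤ 1` matter.) -/
structure IsTransverseDiskFamily (F : CodimOneFoliation M) (g : ℝ → ℂ → M) : Prop where
  smooth : ContMDiffOn 𝓘(ℝ, ℝ × ℂ) (𝓡 3) ∞ (fun y : ℝ × ℂ => g y.1 y.2)
    (Ioc 0 1 ×ˢ closedBall 0 1)
  immersion : ∀ t ∈ Ioc (0 : ℝ) 1, ∀ x ∈ closedBall (0 : ℂ) 1,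
    Function.Injective (mfderivWithin 𝓘(ℝ, ℂ) (𝓡 3) (g t) (closedBall 0 1) x)
  leafwise : ∀ t ∈ Ioc (0 : ℝ) 1, ∃ L, F.IsLeaf L ∧ MapsTo (g t) (closedBall 0 1) L
  transverse : ∀ x ∈ closedBall (0 : ℂ) 1, ∀ t ∈ Ioc (0 : ℝ) 1,
    mfderivWithin 𝓘(ℝ, ℝ) (𝓡 3) (fun s => g s x) (Ioc 0 1) t (1 : ℝ) ∉ F.tangentPlane (g t x)

end Foliations

/-- Convergence as `t → 0⁺` of maps to a compact Hausdorff space in the `C⁰` topology: uniform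
convergence for the unique uniform structure of the target. -/
def TendstoC0 {X M : Type*} [TopologicalSpace M] [CompactSpace M] [T2Space M] (f : ℝ → X → M) (f₀ : X → M) : Prop :=
  @TendstoUniformly X M ℝ uniformSpaceOfCompactR1 f f₀ (𝓝[>] (0 : ℝ))

/-!
Why the boundary curve bounds in its leaf. Write `f_t = π ∘ g_t` for the disks composed with the
branched cover. On the open disk `f_t` is an open map, a branched immersion
(`CodimOneFoliation.nhds_le_map_comp`), and the boundary curves of the `f_t` converge to `π ∘ gb`.
Let `q` be a value off this limit curve which is not a critical value. For small `t` the preimages of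
`q` under `f_t` stay away from the boundary, so by the implicit function theorem they are finitely
many and their number does not depend on `t` (`IsTransverseDiskFamily.exists_ncard_preimage`).

This bounds the size of the disks. Cover the image of `π` by finitely many connected open sets, so
small that a connected leafwise piece lying over one of them is contained in a single plaque of
one of finitely many flow boxes, in which `π` has the form `(z, t) ↦ γ t + z ^ m`
(`CodimOneFoliation.exists_isOpen_forall_plaqueRel`). A component of the preimage of such a set
under `f_t` either meets the boundary of the disk or maps onto the set
(`subset_image_connectedComponentIn`), and then contains one of the boundedly many preimages of a
marked value. Hence every point of the disk is reached from the boundary by a chain of components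
whose length is bounded independently of `t` (`iterate_pieceNhd_eq_univ`), and its image under
`g_t` is reached from the boundary curve by a chain of plaques of bounded length
(`IsTransverseDiskFamily.exists_eventually_mem_iterate_plaqueNhd`).

Consequently the disks accumulate, as `t → 0`, only on the set `K` of points reached from the limit
curve by such chains, and `K` is compact for the leaf topology of `L`. The plaques of a
leaf-compact set in a flow box are finite in number, hence separated, so a single disk `g_t`
sufficiently close to `K` determines at each of its points one nearby plaque. Moving the disk into
these plaques, one flow box after the other and with Tietze's theorem inside each plaque, extends
`gb` to a leafwise continuous map of the disk
(`CodimOneFoliation.exists_leafContinuousOn_extension`).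

The leaf topology enters through its neighbourhood filters: they are traces of neighbourhoods on the
level sets of the transverse coordinate (`CodimOneFoliation.IsAdapted.nhds_leaf`). Continuous maps
into a leaf are continuous for the leaf topology because a leaf meets each chart in countably many
plaques (`CodimOneFoliation.IsLeaf.countable_levels`).
-/

namespace CodimOneFoliation

variable {M : Type*} [TopologicalSpace M] [ChartedSpace E3 M] (F : CodimOneFoliation M)

/-! ### The leaf topology -/

/-- A topological chart of `M` with values in `ℂ × ℝ` whose second coordinate has, locally, the
plaques of the foliation as level sets. No smoothness is required, so that both foliated charts
and the charts straightened along a map to the projective line are covered. -/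
def IsAdapted (φ : OpenPartialHomeomorph M (ℂ × ℝ)) : Prop :=
  ∀ e ∈ F.charts, ∀ p ∈ φ.source ∩ e.source, ∃ U ∈ 𝓝 p, ∀ q ∈ U, ∀ r ∈ U,
    ((φ q).2 = (φ r).2 ↔ e q 2 = e r 2)

/-- Continuity on a set for the leaf topology of the target. -/
def LeafContinuousOn {X : Type*} [TopologicalSpace X] (f : X → M) (s : Set X) : Prop :=
  @ContinuousOn X M _ F.leafTopology f s

/-- Compactness for the leaf topology. -/
def IsLeafCompact (K : Set M) : Prop := @IsCompact M F.leafTopology K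

/-- The leaf neighbourhoods of a point are the traces of its neighbourhoods on the level set of any
function whose germ at the point cuts out the plaques. -/
theorem nhds_leaf_of_eventually {τ : M → ℝ} {p : M}
    (h : ∀ e ∈ F.charts, p ∈ e.source → ∀ᶠ q in 𝓝 p, (τ q = τ p ↔ e q 2 = e p 2)) :
    @nhds M F.leafTopology p = 𝓝 p ⊓ 𝓟 {q | τ q = τ p} := by
  have hN := @TopologicalSpace.nhds_generateFrom M
    {P | ∃ e ∈ F.charts, ∃ U : Set M, IsOpen U ∧ ∃ c : ℝ, P = {p ∈ e.source ∩ U | e p 2 = c}} p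
  change @nhds M F.leafTopology p = _ at hN
  rw [hN]
  apply le_antisymm
  · intro s hs
    have hU := mem_inf_principal.1 hs
    obtain ⟨e, he, hpe⟩ := F.covers p
    obtain ⟨W, hW, hWo, hpW⟩ := mem_nhds_iff.1 (inter_mem hU (h e he hpe))
    refine mem_of_superset (mem_iInf_of_mem {q ∈ e.source ∩ W | e q 2 = e p 2}
      (mem_iInf_of_mem ⟨⟨⟨hpe, hpW⟩, rfl⟩, e, he, W, hWo, _, rfl⟩ (mem_principal_self _))) ?_
    rintro q ⟨⟨-, hqW⟩, hq⟩
    exact (hW hqW).1 ((hW hqW).2.2 hq)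
  · refine le_iInf₂ ?_
    rintro s ⟨hps, e, he, U, hU, c, rfl⟩
    obtain ⟨⟨hpe, hpU⟩, rfl⟩ := hps
    rw [le_principal_iff, mem_inf_principal]
    filter_upwards [h e he hpe, e.open_source.mem_nhds hpe, hU.mem_nhds hpU] with q h1 h2 h3 h4
    exact ⟨⟨h2, h3⟩, h1.1 h4⟩

theorem nhds_leaf_of_chart {e : OpenPartialHomeomorph M E3} (he : e ∈ F.charts) {p : M}
    (hp : p ∈ e.source) : @nhds M F.leafTopology p = 𝓝 p ⊓ 𝓟 {q | e q 2 = e p 2} := by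
  refine F.nhds_leaf_of_eventually fun e' he' hp' => ?_
  obtain ⟨U, hU, h⟩ := F.compatible e he e' he' p ⟨hp, hp'⟩
  filter_upwards [hU] with q hq using h q hq p (mem_of_mem_nhds hU)

variable {F}

theorem IsAdapted.nhds_leaf {φ : OpenPartialHomeomorph M (ℂ × ℝ)} (hφ : F.IsAdapted φ) {p : M}
    (hp : p ∈ φ.source) : @nhds M F.leafTopology p = 𝓝 p ⊓ 𝓟 {q | (φ q).2 = (φ p).2} := by
  refine F.nhds_leaf_of_eventually (τ := fun q => (φ q).2) fun e' he' hp' => ?_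
  obtain ⟨U, hU, h⟩ := hφ e' he' p ⟨hp, hp'⟩
  filter_upwards [hU] with q hq using h q hq p (mem_of_mem_nhds hU)

variable (F)

theorem leafTopology_le : F.leafTopology ≤ ‹TopologicalSpace M› := by
  refine (@le_iff_nhds M F.leafTopology _).2 fun p => ?_
  obtain ⟨e, he, hp⟩ := F.covers p
  rw [F.nhds_leaf_of_chart he hp]
  exact inf_le_left

variable {F}

section LeafContinuous

variable {X : Type*} [TopologicalSpace X] {f : X → M} {s : Set X}

theorem LeafContinuousOn.continuousOn (hf : F.LeafContinuousOn f s) : ContinuousOn f s :=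
  fun x hx => (hf x hx).mono_right ((@le_iff_nhds M F.leafTopology _).1 F.leafTopology_le _)

theorem LeafContinuousOn.mono (hf : F.LeafContinuousOn f s) {t : Set X} (h : t ⊆ s) :
    F.LeafContinuousOn f t := @ContinuousOn.mono X M _ F.leafTopology f s t hf h

theorem LeafContinuousOn.domRestrict (hf : F.LeafContinuousOn f s) :
    F.LeafContinuousOn (fun x : s => f x) univ :=
  (@continuousOn_univ _ M _ F.leafTopology _).2
    ((@continuousOn_iff_continuous_domRestrict X M _ F.leafTopology _ _).1 hf)

/-- Along a leafwise continuous map, the transverse coordinate is locally constant. -/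
theorem LeafContinuousOn.eventually_eq (hf : F.LeafContinuousOn f s)
    {φ : OpenPartialHomeomorph M (ℂ × ℝ)} (hφ : F.IsAdapted φ) {x : X} (hx : x ∈ s)
    (hp : f x ∈ φ.source) : ∀ᶠ y in 𝓝[s] x, (φ (f y)).2 = (φ (f x)).2 := by
  have h : Tendsto f (𝓝[s] x) (@nhds M F.leafTopology (f x)) := hf x hx
  rw [hφ.nhds_leaf hp, tendsto_inf, tendsto_principal] at h
  exact h.2

theorem LeafContinuousOn.eventually_eq_chart (hf : F.LeafContinuousOn f s)
    {e : OpenPartialHomeomorph M E3} (he : e ∈ F.charts) {x : X} (hx : x ∈ s)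
    (hp : f x ∈ e.source) : ∀ᶠ y in 𝓝[s] x, e (f y) 2 = e (f x) 2 := by
  have h : Tendsto f (𝓝[s] x) (@nhds M F.leafTopology (f x)) := hf x hx
  rw [F.nhds_leaf_of_chart he hp, tendsto_inf, tendsto_principal] at h
  exact h.2

theorem leafContinuousOn_of_adapted (hf : ContinuousOn f s)
    (h : ∀ x ∈ s, ∃ φ : OpenPartialHomeomorph M (ℂ × ℝ), F.IsAdapted φ ∧ f x ∈ φ.source ∧
      ∀ᶠ y in 𝓝[s] x, (φ (f y)).2 = (φ (f x)).2) : F.LeafContinuousOn f s := by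
  intro x hx
  obtain ⟨φ, hφ, hp, hc⟩ := h x hx
  change Tendsto f (𝓝[s] x) (@nhds M F.leafTopology (f x))
  rw [hφ.nhds_leaf hp, tendsto_inf, tendsto_principal]
  exact ⟨hf x hx, hc⟩

theorem leafContinuousOn_of_chart (hf : ContinuousOn f s)
    (h : ∀ x ∈ s, ∃ e ∈ F.charts, f x ∈ e.source ∧
      ∀ᶠ y in 𝓝[s] x, e (f y) 2 = e (f x) 2) : F.LeafContinuousOn f s := by
  intro x hx
  obtain ⟨e, he, hp, hc⟩ := h x hx
  change Tendsto f (𝓝[s] x) (@nhds M F.leafTopology (f x))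
  rw [F.nhds_leaf_of_chart he hp, tendsto_inf, tendsto_principal]
  exact ⟨hf x hx, hc⟩

end LeafContinuous

/-! ### Leaves have countably many plaques -/

theorem _root_.Set.countable_image_of_eventually_eq {X Y : Type*} [TopologicalSpace X]
    [SecondCountableTopology X] {f : X → Y} {s : Set X}
    (h : ∀ x ∈ s, ∀ᶠ y in 𝓝[s] x, f y = f x) : (f '' s).Countable := by
  obtain ⟨t, -, htc, ht⟩ := TopologicalSpace.countable_cover_nhdsWithin h
  refine (htc.image f).mono ?_
  rintro _ ⟨x, hx, rfl⟩
  obtain ⟨y, hy, hxy⟩ := mem_iUnion₂.1 (ht hx)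
  exact ⟨y, hy, (show f x = f y from hxy).symm⟩

variable (F) in
theorem isOpen_leaf_level {e : OpenPartialHomeomorph M E3} (he : e ∈ F.charts) (c : ℝ) :
    @IsOpen M F.leafTopology {p ∈ e.source | e p 2 = c} :=
  TopologicalSpace.isOpen_generateFrom_of_mem ⟨e, he, univ, isOpen_univ, c, by simp⟩

variable (F) in
theorem countable_level_inter [SecondCountableTopology M] {e e' : OpenPartialHomeomorph M E3}
    (he : e ∈ F.charts) (he' : e' ∈ F.charts) (c : ℝ) :
    ((fun p => e' p 2) '' {p ∈ e.source ∩ e'.source | e p 2 = c}).Countable := by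
  refine countable_image_of_eventually_eq fun p hp => ?_
  obtain ⟨U, hU, h⟩ := F.compatible e he e' he' p hp.1
  filter_upwards [mem_nhdsWithin_of_mem_nhds hU, self_mem_nhdsWithin] with q hq hq'
  exact (h q hq p (mem_of_mem_nhds hU)).1 (hq'.2.trans hp.2.symm)

/-- A leaf meets a foliated chart in countably many plaques: starting with one plaque and adding
those which meet the ones already found, in a countable atlas, gives a set which is open and closed
for the leaf topology. -/
theorem IsLeaf.countable_levels [SecondCountableTopology M] {L : Set M} (hL : F.IsLeaf L)
    {e : OpenPartialHomeomorph M E3} (he : e ∈ F.charts) :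
    ((fun p => e p 2) '' (L ∩ e.source)).Countable := by
  obtain ⟨p₀, rfl⟩ := hL
  obtain ⟨S, hSc, hSF, hScov⟩ : ∃ S : Set (OpenPartialHomeomorph M E3), S.Countable ∧
      S ⊆ F.charts ∧ ∀ p, ∃ e ∈ S, p ∈ e.source := by
    choose E hE hpE using F.covers
    obtain ⟨t, htc, ht⟩ := TopologicalSpace.countable_cover_nhds
      (fun p => (E p).open_source.mem_nhds (hpE p))
    refine ⟨E '' t, htc.image _, by rintro _ ⟨p, -, rfl⟩; exact hE p, fun p => ?_⟩
    obtain ⟨q, hq, hpq⟩ := mem_iUnion₂.1 (ht ▸ mem_univ p)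
    exact ⟨E q, mem_image_of_mem _ hq, hpq⟩
  obtain ⟨e₀, he₀, hp₀⟩ := hScov p₀
  let P : OpenPartialHomeomorph M E3 × ℝ → Set M := fun a => {p ∈ a.1.source | a.1 p 2 = a.2}
  let A : ℕ → Set (OpenPartialHomeomorph M E3 × ℝ) := fun n => Nat.rec {(e₀, e₀ p₀ 2)}
    (fun _ A => {b | b.1 ∈ S ∧ ∃ a ∈ A, (P b ∩ P a).Nonempty}) n
  have hAsucc : ∀ n, A (n + 1) = {b | b.1 ∈ S ∧ ∃ a ∈ A n, (P b ∩ P a).Nonempty} := fun n => rfl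
  have hAS : ∀ n, ∀ a ∈ A n, a.1 ∈ S := by
    rintro (_ | n) a ha
    · obtain rfl : a = _ := ha
      exact he₀
    · exact ha.1
  have hAc : ∀ n, (A n).Countable := by
    intro n
    induction n with
    | zero => exact countable_singleton _
    | succ n ih =>
      refine (Countable.biUnion ih fun a ha => hSc.biUnion fun e' he' =>
        ((F.countable_level_inter (hSF (hAS n a ha)) (hSF he') a.2).image
          (fun c => (e', c)))).mono ?_
      rw [hAsucc]
      rintro ⟨e', c⟩ ⟨he', a, ha, p, hp, hp'⟩
      exact mem_iUnion₂.2 ⟨a, ha, mem_iUnion₂.2 ⟨e', he', c, ⟨p, ⟨⟨hp'.1, hp.1⟩, hp'.2⟩, hp.2⟩, rfl⟩⟩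
  let U : Set M := ⋃ n, ⋃ a ∈ A n, P a
  have hclopen : @IsClopen M F.leafTopology U := by
    constructor
    · refine (@isOpen_compl_iff M _ F.leafTopology).1 ((@isOpen_iff_mem_nhds M F.leafTopology _).2 ?_)
      intro p hp
      obtain ⟨e', he', hpe'⟩ := hScov p
      refine mem_of_superset (@IsOpen.mem_nhds M F.leafTopology _ _
        (F.isOpen_leaf_level (hSF he') (e' p 2)) ⟨hpe', rfl⟩) ?_
      intro q hq hqU
      obtain ⟨n, hn⟩ := mem_iUnion.1 hqU
      obtain ⟨a, ha, hqa⟩ := mem_iUnion₂.1 hn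
      exact hp (mem_iUnion.2 ⟨n + 1, mem_iUnion₂.2 ⟨(e', e' p 2), ⟨he', a, ha, q, hq, hqa⟩,
        hpe', rfl⟩⟩)
    · exact @isOpen_iUnion M _ F.leafTopology _ fun n => @isOpen_biUnion M _ F.leafTopology _ _
        fun a ha => F.isOpen_leaf_level (hSF (hAS n a ha)) a.2
  have hsub : @pathComponent M F.leafTopology p₀ ⊆ U :=
    (@pathComponent_subset_component M F.leafTopology p₀).trans
      (@IsClopen.connectedComponent_subset M F.leafTopology _ _ hclopen
        (mem_iUnion.2 ⟨0, mem_iUnion₂.2 ⟨(e₀, e₀ p₀ 2), rfl, hp₀, rfl⟩⟩))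
  refine (countable_iUnion fun n => (hAc n).biUnion fun a ha =>
    F.countable_level_inter (hSF (hAS n a ha)) he a.2).mono ?_
  rintro _ ⟨p, ⟨hpL, hpe⟩, rfl⟩
  obtain ⟨n, hn⟩ := mem_iUnion.1 (hsub hpL)
  obtain ⟨a, ha, hpa⟩ := mem_iUnion₂.1 hn
  exact mem_iUnion.2 ⟨n, mem_iUnion₂.2 ⟨a, ha, p, ⟨⟨hpa.1, hpe⟩, hpa.2⟩, rfl⟩⟩

/-- A continuous map with values in a leaf is continuous for the leaf topology. -/
theorem IsLeaf.leafContinuousOn [SecondCountableTopology M] {L : Set M} (hL : F.IsLeaf L)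
    {X : Type*} [TopologicalSpace X] [LocallyConnectedSpace X] {f : X → M} (hf : Continuous f)
    (hfL : ∀ x, f x ∈ L) : F.LeafContinuousOn f univ := by
  refine leafContinuousOn_of_chart hf.continuousOn fun x _ => ?_
  obtain ⟨e, he, hp⟩ := F.covers (f x)
  refine ⟨e, he, hp, ?_⟩
  rw [nhdsWithin_univ]
  obtain ⟨V, ⟨hVo, hxV, hVc⟩, hV⟩ := (LocallyConnectedSpace.open_connected_basis x).mem_iff.1
    (hf.continuousAt.preimage_mem_nhds (e.open_source.mem_nhds hp))
  filter_upwards [hVo.mem_nhds hxV] with y hy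
  have hcont : ContinuousOn (fun y => e (f y) 2) V := by
    have h1 : ContinuousOn (fun y => e (f y)) V := e.continuousOn.comp hf.continuousOn hV
    exact (EuclideanSpace.proj (𝕜 := ℝ) (2 : Fin 3)).continuous.comp_continuousOn h1
  refine ((hL.countable_levels he).isTotallyDisconnected) ((fun y => e (f y) 2) '' V) ?_
    (hVc.isPreconnected.image _ hcont) ⟨y, hy, rfl⟩ ⟨x, hxV, rfl⟩
  rintro _ ⟨z, hz, rfl⟩
  exact ⟨f z, ⟨hfL z, hV hz⟩, rfl⟩

end CodimOneFoliation

namespace CodimOneFoliation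

variable {M : Type*} [TopologicalSpace M] [ChartedSpace E3 M] {F : CodimOneFoliation M}

/-! ### Flow boxes -/

variable (F) in
/-- A flow box: an adapted chart together with a closed ball of its target centred at the origin.
As `ℂ × ℝ` carries the sup norm, this ball is a product of a disk and an interval. -/
structure FlowBox where
  /-- the chart -/
  chart : OpenPartialHomeomorph M (ℂ × ℝ)
  /-- the radius of the ball -/
  radius : ℝ
  adapted : F.IsAdapted chart
  radius_pos : 0 < radius
  closedBall_subset : closedBall 0 radius ⊆ chart.target

namespace FlowBox

variable (B : F.FlowBox)

/-- The part of the flow box in which the coordinates have norm at most `r`. -/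
def cell (r : ℝ) : Set M := {p ∈ B.chart.source | ‖B.chart p‖ ≤ r}

variable {B}

theorem cell_mono {r s : ℝ} (h : r ≤ s) : B.cell r ⊆ B.cell s := fun _ hp => ⟨hp.1, hp.2.trans h⟩

theorem mem_target {w : ℂ × ℝ} (hw : ‖w‖ ≤ B.radius) : w ∈ B.chart.target :=
  B.closedBall_subset (mem_closedBall_zero_iff.2 hw)

theorem symm_mem_cell {w : ℂ × ℝ} (hw : ‖w‖ ≤ B.radius) : B.chart.symm w ∈ B.cell B.radius :=
  ⟨B.chart.map_target (mem_target hw), by rwa [B.chart.right_inv (mem_target hw)]⟩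

variable (B) in
theorem cell_eq_image {r : ℝ} (hr : r ≤ B.radius) : B.cell r = B.chart.symm '' closedBall 0 r := by
  ext p
  constructor
  · rintro ⟨hp, hpr⟩
    exact ⟨B.chart p, mem_closedBall_zero_iff.2 hpr, B.chart.left_inv hp⟩
  · rintro ⟨w, hw, rfl⟩
    rw [mem_closedBall_zero_iff] at hw
    have hw' := mem_target (hw.trans hr)
    exact ⟨B.chart.map_target hw', by rwa [B.chart.right_inv hw']⟩

variable (B) in
theorem isCompact_cell {r : ℝ} (hr : r ≤ B.radius) : IsCompact (B.cell r) := by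
  rw [B.cell_eq_image hr]
  exact (isCompact_closedBall _ _).image_of_continuousOn
    (B.chart.continuousOn_symm.mono ((closedBall_subset_closedBall hr).trans B.closedBall_subset))

variable (B) in
theorem isClosed_cell [T2Space M] {r : ℝ} (hr : r ≤ B.radius) : IsClosed (B.cell r) :=
  (B.isCompact_cell hr).isClosed

/-- A leaf-compact set meets a flow box in finitely many plaques. -/
theorem finite_levels [T2Space M] {K : Set M} (hK : F.IsLeafCompact K) {r : ℝ}
    (hr : r ≤ B.radius) : ((fun p => (B.chart p).2) '' (K ∩ B.cell r)).Finite := by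
  have hc : @IsCompact M F.leafTopology (K ∩ B.cell r) :=
    @IsCompact.inter_right M F.leafTopology _ _ hK ((B.isClosed_cell hr).mono F.leafTopology_le)
  obtain ⟨t, htK, ht⟩ := @IsCompact.elim_nhds_subcover M F.leafTopology _ hc
    (fun p => {q | (B.chart q).2 = (B.chart p).2}) fun p hp => by
      rw [B.adapted.nhds_leaf hp.2.1]
      exact mem_inf_of_right (mem_principal_self _)
  refine (t.finite_toSet.image fun p => (B.chart p).2).subset ?_
  rintro _ ⟨p, hp, rfl⟩
  obtain ⟨q, hq, hpq⟩ := mem_iUnion₂.1 (ht hp)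
  exact ⟨q, hq, (show (B.chart p).2 = (B.chart q).2 from hpq).symm⟩

/-- A continuous map into the coordinates whose level is locally constant gives a leafwise
continuous map. -/
theorem leafContinuousOn_symm {X : Type*} [TopologicalSpace X] {u : X → ℂ} {c : X → ℝ} {s : Set X}
    (hu : ContinuousOn u s) (hc : ∀ x ∈ s, ∀ᶠ y in 𝓝[s] x, c y = c x)
    (hr : ∀ x ∈ s, ‖(u x, c x)‖ ≤ B.radius) :
    F.LeafContinuousOn (fun x => B.chart.symm (u x, c x)) s := by
  have hcc : ContinuousOn c s := fun x hx =>
    (tendsto_const_nhds.congr' ((hc x hx).mono fun _ h => h.symm) :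
      Tendsto c (𝓝[s] x) (𝓝 (c x)))
  refine leafContinuousOn_of_adapted
    (B.chart.continuousOn_symm.comp (hu.prodMk hcc) fun x hx => mem_target (hr x hx)) fun x hx =>
    ⟨B.chart, B.adapted, B.chart.map_target (mem_target (hr x hx)), ?_⟩
  filter_upwards [hc x hx, self_mem_nhdsWithin] with y hy hys
  rw [B.chart.right_inv (mem_target (hr y hys)), B.chart.right_inv (mem_target (hr x hx))]
  exact hy

/-- Two points of the box are related if they lie on the same plaque. -/
def plaqueRel (B : F.FlowBox) : Set (M × M) :=
  {x | x.1 ∈ B.cell B.radius ∧ x.2 ∈ B.cell B.radius ∧ (B.chart x.1).2 = (B.chart x.2).2}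

theorem isCompact_plaqueRel : IsCompact B.plaqueRel := by
  have h : B.plaqueRel = (fun x : (ℂ × ℝ) × (ℂ × ℝ) => (B.chart.symm x.1, B.chart.symm x.2)) ''
      {x | x ∈ closedBall (0 : ℂ × ℝ) B.radius ×ˢ closedBall (0 : ℂ × ℝ) B.radius ∧
        x.1.2 = x.2.2} := by
    ext ⟨p, q⟩
    constructor
    · rintro ⟨hp, hq, h⟩
      exact ⟨(B.chart p, B.chart q), ⟨⟨mem_closedBall_zero_iff.2 hp.2,
        mem_closedBall_zero_iff.2 hq.2⟩, h⟩,
        Prod.ext (B.chart.left_inv hp.1) (B.chart.left_inv hq.1)⟩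
    · rintro ⟨⟨v, w⟩, ⟨⟨hv, hw⟩, h⟩, hvw⟩
      rw [mem_closedBall_zero_iff] at hv hw
      obtain ⟨rfl, rfl⟩ := Prod.ext_iff.1 hvw
      refine ⟨symm_mem_cell hv, symm_mem_cell hw, ?_⟩
      change (B.chart (B.chart.symm v)).2 = (B.chart (B.chart.symm w)).2
      rw [B.chart.right_inv (mem_target hv), B.chart.right_inv (mem_target hw)]
      exact h
  rw [h]
  refine IsCompact.image_of_continuousOn ?_ ?_
  · exact ((isCompact_closedBall _ _).prod (isCompact_closedBall _ _)).inter_right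
      (isClosed_eq (by fun_prop) (by fun_prop))
  · refine ContinuousOn.prodMk ?_ ?_
    · exact B.chart.continuousOn_symm.comp continuousOn_fst fun x hx => B.closedBall_subset hx.1.1
    · exact B.chart.continuousOn_symm.comp continuousOn_snd fun x hx => B.closedBall_subset hx.1.2

/-- Points close to a point of a smaller cell have close coordinates. -/
theorem eventually_dist_chart_lt [T2Space M] {r η : ℝ} (hr : r ≤ B.radius) (hη : 0 < η) :
    {x : M × M | x.1 ∈ B.cell r → x.2 ∈ B.chart.source ∧ ‖B.chart x.2 - B.chart x.1‖ < η} ∈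
      𝓝ˢ (diagonal M) := by
  rw [mem_nhdsSet_iff_forall]
  rintro ⟨p, q⟩ (rfl : p = q)
  by_cases hp : p ∈ B.cell r
  · have h1 : ContinuousAt (fun x : M × M => B.chart x.2 - B.chart x.1) (p, p) :=
      ((B.chart.continuousAt hp.1).comp' continuousAt_snd).sub
        ((B.chart.continuousAt hp.1).comp' continuousAt_fst)
    have h2 : ∀ᶠ x : M × M in 𝓝 (p, p), ‖B.chart x.2 - B.chart x.1‖ < η := by
      refine h1.norm.eventually_lt continuousAt_const ?_
      simpa using hη
    have h3 : ∀ᶠ x : M × M in 𝓝 (p, p), x.2 ∈ B.chart.source :=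
      continuousAt_snd.eventually (B.chart.open_source.mem_nhds hp.1)
    filter_upwards [h2, h3] with x h2 h3 _ using ⟨h3, h2⟩
  · have h : ∀ᶠ x : M × M in 𝓝 (p, p), x.1 ∈ (B.cell r)ᶜ :=
      continuousAt_fst.eventually ((B.isClosed_cell hr).isOpen_compl.mem_nhds hp)
    filter_upwards [h] with x hx hx' using absurd hx' hx

/-- Points with close coordinates are close. -/
theorem exists_mem_of_dist_le {O : Set (M × M)} (hO : O ∈ 𝓝ˢ (diagonal M)) {r : ℝ}
    (hr : r < B.radius) : ∃ η > 0, ∀ p ∈ B.cell r, ∀ w : ℂ × ℝ, ‖w - B.chart p‖ ≤ η →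
      ‖w‖ ≤ B.radius ∧ (p, B.chart.symm w) ∈ O := by
  obtain ⟨O', hO'o, hdO', hO'O⟩ := mem_nhdsSet_iff_exists.1 hO
  let Ψ : (ℂ × ℝ) × (ℂ × ℝ) → M × M := fun x => (B.chart.symm x.1, B.chart.symm x.2)
  have hΨ : ContinuousOn Ψ (B.chart.target ×ˢ B.chart.target) :=
    (B.chart.continuousOn_symm.comp continuousOn_fst fun x hx => hx.1).prodMk
      (B.chart.continuousOn_symm.comp continuousOn_snd fun x hx => hx.2)
  have hopen := hΨ.isOpen_inter_preimage
    (B.chart.open_target.prod B.chart.open_target) hO'o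
  have hcomp : IsCompact ((fun v : ℂ × ℝ => (v, v)) '' closedBall 0 r) :=
    (isCompact_closedBall _ _).image (by fun_prop)
  obtain ⟨δ, hδ, hsub⟩ := hcomp.exists_cthickening_subset_open hopen (by
    rintro _ ⟨v, hv, rfl⟩
    have hv' : v ∈ B.chart.target :=
      B.closedBall_subset (closedBall_subset_closedBall hr.le hv)
    exact ⟨⟨hv', hv'⟩, hdO' rfl⟩)
  refine ⟨min δ (B.radius - r), lt_min hδ (sub_pos.2 hr), fun p hp w hw => ⟨?_, ?_⟩⟩
  · have h1 : ‖w‖ ≤ ‖w - B.chart p‖ + ‖B.chart p‖ := by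
      simpa using norm_add_le (w - B.chart p) (B.chart p)
    have h2 := hp.2
    have h3 := hw.trans (min_le_right _ _)
    linarith
  · have h : (B.chart p, w) ∈ cthickening δ ((fun v : ℂ × ℝ => (v, v)) '' closedBall 0 r) := by
      refine mem_cthickening_of_dist_le _ (B.chart p, B.chart p) _ _
        ⟨_, mem_closedBall_zero_iff.2 hp.2, rfl⟩ ?_
      rw [Prod.dist_eq]
      simpa [dist_eq_norm, hδ.le] using hw.trans (min_le_left _ _)
    have := hO'O (hsub h).2
    simpa [Ψ, B.chart.left_inv hp.1] using this

end FlowBox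

theorem _root_.Set.Finite.exists_pos_forall_eq_of_abs_sub_lt {s : Set ℝ} (hs : s.Finite) :
    ∃ η > 0, ∀ a ∈ s, ∀ b ∈ s, |a - b| < η → a = b := by
  have := hs.to_subtype
  obtain ⟨C, hC, h⟩ := Set.relatively_discrete_of_finite (s := s)
  obtain ⟨η, -, hη0, hη⟩ := ENNReal.lt_iff_exists_real_btwn.1 hC
  refine ⟨η, ENNReal.ofReal_pos.1 hη0, fun a ha b hb hab => by_contra fun hne => ?_⟩
  have h1 := h a ha b hb hne
  rw [edist_dist, Real.dist_eq] at h1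
  exact absurd (h1.trans (ENNReal.ofReal_le_ofReal hab.le)) (not_le.2 hη)

/-! ### Extending leafwise maps -/

section Extension

variable [T2Space M] {X : Type*} [TopologicalSpace X] [NormalSpace X]

/-- Let `K'` be leaf-compact and contain the plaques of the flow box `B` which meet `K`, and let `g`
be a leafwise continuous map close to `K`. A leafwise continuous map into `K'` which is defined on a
closed set and close to `g` extends over the preimage under `g` of a smaller cell of `B`.

The plaques of `K'` in the box are separated, so nearness to `g` determines a plaque, which is
locally constant; inside that plaque, the difference to the coordinate of `g` is extended by Tietze's
theorem, which does not increase its norm. -/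
theorem FlowBox.exists_extension_cell (B : F.FlowBox) {K K' : Set M} (hK' : F.IsLeafCompact K')
    (hKK' : K ⊆ K') (hB : ∀ x ∈ B.plaqueRel, x.1 ∈ K → x.2 ∈ K') {r : ℝ} (hr : r < B.radius)
    {O' : Set (M × M)} (hO' : O' ∈ 𝓝ˢ (diagonal M)) :
    ∃ O ∈ 𝓝ˢ (diagonal M), O ⊆ O' ∧ ∀ (g h : X → M) (A : Set X),
      F.LeafContinuousOn g univ → (∀ x, ∃ p ∈ K, (g x, p) ∈ O) →
      IsClosed A → F.LeafContinuousOn h A → MapsTo h A K' → (∀ x ∈ A, (g x, h x) ∈ O) →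
      ∃ h' : X → M, F.LeafContinuousOn h' (A ∪ g ⁻¹' B.cell r) ∧ EqOn h' h A ∧
        MapsTo h' (A ∪ g ⁻¹' B.cell r) K' ∧ ∀ x ∈ A ∪ g ⁻¹' B.cell r, (g x, h' x) ∈ O' := by
  obtain ⟨η₁, hη₁, hclose⟩ := FlowBox.exists_mem_of_dist_le hO' hr
  obtain ⟨η₂, hη₂, hsep⟩ :=
    (B.finite_levels hK' le_rfl).exists_pos_forall_eq_of_abs_sub_lt
  let η := min η₁ (η₂ / 2)
  have hη : 0 < η := lt_min hη₁ (half_pos hη₂)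
  have hη1 : η ≤ η₁ := min_le_left _ _
  have hη2 : 2 * η ≤ η₂ := by have := min_le_right η₁ (η₂ / 2); simp only [η]; linarith
  have hO₁ := B.eventually_dist_chart_lt hr.le hη
  refine ⟨_ ∩ O', inter_mem hO₁ hO', inter_subset_right, ?_⟩
  intro g h A hg hgK hA hh hhK' hgh
  choose p hpK hp using hgK
  have hgc : Continuous g := continuousOn_univ.1 hg.continuousOn
  have hG : IsClosed (g ⁻¹' B.cell r) := (B.isClosed_cell hr.le).preimage hgc
  -- a point near the small cell lies in the big cell
  have hcell : ∀ x ∈ g ⁻¹' B.cell r, ∀ q, q ∈ B.chart.source → ‖B.chart q - B.chart (g x)‖ < η →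
      q ∈ B.cell B.radius := fun x hx q hq hqx =>
    ⟨hq, (hclose (g x) hx (B.chart q) (hqx.le.trans hη1)).1⟩
  have hpcell : ∀ x ∈ g ⁻¹' B.cell r, p x ∈ B.cell B.radius := fun x hx =>
    hcell x hx _ ((hp x).1 hx).1 ((hp x).1 hx).2
  have hplev : ∀ x ∈ g ⁻¹' B.cell r, |(B.chart (p x)).2 - (B.chart (g x)).2| < η := fun x hx =>
    (norm_snd_le (B.chart (p x) - B.chart (g x))).trans_lt ((hp x).1 hx).2
  have hhcell : ∀ x ∈ A ∩ g ⁻¹' B.cell r, h x ∈ B.cell B.radius := fun x hx =>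
    hcell x hx.2 _ ((hgh x hx.1).1 hx.2).1 ((hgh x hx.1).1 hx.2).2
  have hhlev : ∀ x ∈ A ∩ g ⁻¹' B.cell r, (B.chart (h x)).2 = (B.chart (p x)).2 := by
    intro x hx
    refine hsep _ ⟨h x, ⟨hhK' hx.1, hhcell x hx⟩, rfl⟩ _
      ⟨p x, ⟨hKK' (hpK x), hpcell x hx.2⟩, rfl⟩ ?_
    have h1 : |(B.chart (h x)).2 - (B.chart (g x)).2| < η :=
      (norm_snd_le (B.chart (h x) - B.chart (g x))).trans_lt ((hgh x hx.1).1 hx.2).2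
    have h2 := hplev x hx.2
    rw [abs_lt] at h1 h2 ⊢
    constructor <;> linarith
  have hploc : ∀ x ∈ g ⁻¹' B.cell r, ∀ᶠ y in 𝓝[g ⁻¹' B.cell r] x,
      (B.chart (p y)).2 = (B.chart (p x)).2 := by
    intro x hx
    filter_upwards [(hg.mono (subset_univ _)).eventually_eq B.adapted hx hx.1,
      self_mem_nhdsWithin] with y hy hyG
    refine hsep _ ⟨p y, ⟨hKK' (hpK y), hpcell y hyG⟩, rfl⟩ _
      ⟨p x, ⟨hKK' (hpK x), hpcell x hx⟩, rfl⟩ ?_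
    have h1 := hplev x hx
    have h2 := hplev y hyG
    rw [hy] at h2
    rw [abs_lt] at h1 h2 ⊢
    constructor <;> linarith
  -- extend the difference of the plaque coordinates
  have hAG : IsClosed (A ∩ g ⁻¹' B.cell r) := hA.inter hG
  have hgz : ContinuousOn (fun x => (B.chart (g x)).1) (g ⁻¹' B.cell r) :=
    continuous_fst.comp_continuousOn (B.chart.continuousOn.comp hgc.continuousOn fun x hx => hx.1)
  have hhz : ContinuousOn (fun x => (B.chart (h x)).1) (A ∩ g ⁻¹' B.cell r) :=
    continuous_fst.comp_continuousOn (B.chart.continuousOn.comp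
      (hh.continuousOn.mono inter_subset_left) fun x hx => (hhcell x hx).1)
  have hdz : ContinuousOn (fun x => (B.chart (h x)).1 - (B.chart (g x)).1)
      (A ∩ g ⁻¹' B.cell r) := hhz.sub (hgz.mono inter_subset_right)
  have hdη : ∀ x ∈ A ∩ g ⁻¹' B.cell r,
      (B.chart (h x)).1 - (B.chart (g x)).1 ∈ closedBall (0 : ℂ) η := fun x hx =>
    mem_closedBall_zero_iff.2 ((norm_fst_le (B.chart (h x) - B.chart (g x))).trans
      ((hgh x hx.1).1 hx.2).2.le)
  have hT : TietzeExtension (closedBall (0 : ℂ) η) := Metric.instTietzeExtensionClosedBall ℂ 0 hη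
  obtain ⟨u, hu⟩ := ContinuousMap.exists_restrict_eq hAG
    (⟨fun x => ⟨_, hdη x x.2⟩, (continuousOn_iff_continuous_domRestrict.1 hdz).subtype_mk _⟩ :
      C(↥(A ∩ g ⁻¹' B.cell r), closedBall (0 : ℂ) η))
  have hu' : ∀ x ∈ A ∩ g ⁻¹' B.cell r, (u x : ℂ) = (B.chart (h x)).1 - (B.chart (g x)).1 :=
    fun x hx => congrArg Subtype.val (DFunLike.congr_fun hu ⟨x, hx⟩)
  have hunorm : ∀ x, ‖(u x : ℂ)‖ ≤ η := fun x => mem_closedBall_zero_iff.1 (u x).2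
  let w : X → ℂ × ℝ := fun x => ((B.chart (g x)).1 + u x, (B.chart (p x)).2)
  have hw : ∀ x ∈ g ⁻¹' B.cell r, ‖w x - B.chart (g x)‖ ≤ η := fun x hx => by
    rw [Prod.norm_def]
    refine max_le ?_ (hplev x hx).le
    simpa [w] using hunorm x
  have hwr : ∀ x ∈ g ⁻¹' B.cell r, ‖w x‖ ≤ B.radius := fun x hx =>
    (hclose (g x) hx (w x) ((hw x hx).trans hη1)).1
  have hwh : ∀ x ∈ A ∩ g ⁻¹' B.cell r, B.chart.symm (w x) = h x := fun x hx => by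
    have : w x = B.chart (h x) := Prod.ext (by simp [w, hu' x hx]) (hhlev x hx).symm
    rw [this, B.chart.left_inv (hhcell x hx).1]
  classical
  let h' : X → M := fun x => if x ∈ A then h x else B.chart.symm (w x)
  have hh'A : EqOn h' h A := fun x hx => if_pos hx
  have hh'G : EqOn h' (fun x => B.chart.symm (w x)) (g ⁻¹' B.cell r) := fun x hx => by
    by_cases hxA : x ∈ A
    · exact (if_pos hxA).trans (hwh x ⟨hxA, hx⟩).symm
    · exact if_neg hxA
  refine ⟨h', ?_, hh'A, ?_, ?_⟩
  · refine @ContinuousOn.union_of_isClosed X M _ F.leafTopology _ _ _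
      (@ContinuousOn.congr X M _ F.leafTopology _ _ _ hh hh'A)
      (@ContinuousOn.congr X M _ F.leafTopology _ _ _ ?_ hh'G) hA hG
    exact B.leafContinuousOn_symm
      (hgz.add (continuous_subtype_val.comp u.continuous).continuousOn) hploc hwr
  · rintro x (hx | hx)
    · rw [hh'A hx]; exact hhK' hx
    · rw [hh'G hx]
      refine hB (p x, _) ⟨hpcell x hx, FlowBox.symm_mem_cell (hwr x hx), ?_⟩ (hpK x)
      change _ = (B.chart (B.chart.symm (w x))).2
      rw [B.chart.right_inv (FlowBox.mem_target (hwr x hx))]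
  · rintro x (hx | hx)
    · rw [hh'A hx]; exact (hgh x hx).2
    · rw [hh'G hx]
      exact (hclose (g x) hx (w x) ((hw x hx).trans hη1)).2

/-- A leafwise continuous map defined on a closed set extends to the whole space if it is close to
a leafwise continuous map `g` which is close to a leaf-compact set. -/
theorem exists_leafContinuousOn_extension {ι : Type*} [Finite ι] (B : ι → F.FlowBox) {r : ι → ℝ}
    (hr : ∀ i, r i < (B i).radius) (hcov : ∀ p, ∃ i, p ∈ (B i).cell (r i)) {K K' : Set M}
    (hK' : F.IsLeafCompact K') (hKK' : K ⊆ K')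
    (hB : ∀ i, ∀ x ∈ (B i).plaqueRel, x.1 ∈ K → x.2 ∈ K') :
    ∃ O ∈ 𝓝ˢ (diagonal M), ∀ (g h : X → M) (A : Set X),
      F.LeafContinuousOn g univ → (∀ x, ∃ p ∈ K, (g x, p) ∈ O) →
      IsClosed A → F.LeafContinuousOn h A → MapsTo h A K' → (∀ x ∈ A, (g x, h x) ∈ O) →
      ∃ h' : X → M, F.LeafContinuousOn h' univ ∧ EqOn h' h A := by
  classical
  have := Fintype.ofFinite ι
  -- extend over the cells of the boxes in `s`, for every prescribed final closeness `O'`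
  have key : ∀ s : Finset ι, ∀ O' ∈ 𝓝ˢ (diagonal M), ∃ O ∈ 𝓝ˢ (diagonal M), O ⊆ O' ∧
      ∀ (g h : X → M) (A : Set X),
      F.LeafContinuousOn g univ → (∀ x, ∃ p ∈ K, (g x, p) ∈ O) →
      IsClosed A → F.LeafContinuousOn h A → MapsTo h A K' → (∀ x ∈ A, (g x, h x) ∈ O) →
      ∃ h' : X → M, F.LeafContinuousOn h' (A ∪ ⋃ i ∈ s, g ⁻¹' (B i).cell (r i)) ∧ EqOn h' h A ∧
        MapsTo h' (A ∪ ⋃ i ∈ s, g ⁻¹' (B i).cell (r i)) K' ∧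
        ∀ x ∈ A ∪ ⋃ i ∈ s, g ⁻¹' (B i).cell (r i), (g x, h' x) ∈ O' := by
    intro s
    induction s using Finset.induction_on with
    | empty =>
      refine fun O' hO' => ⟨O', hO', subset_rfl, fun g h A _ _ _ hh hhK hgh => ⟨h, ?_⟩⟩
      simpa using ⟨hh, fun _ _ => rfl, hhK, hgh⟩
    | insert j s hj ih =>
      intro O' hO'
      obtain ⟨O₁, hO₁, hO₁O', hstep⟩ := (B j).exists_extension_cell (X := X) hK' hKK' (hB j) (hr j) hO'
      obtain ⟨O, hO, hOO₁, hs⟩ := ih O₁ hO₁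
      refine ⟨O, hO, hOO₁.trans hO₁O', fun g h A hg hgK hA hh hhK hgh => ?_⟩
      obtain ⟨h₁, h₁c, h₁h, h₁K, h₁O⟩ := hs g h A hg hgK hA hh hhK hgh
      have hgc : Continuous g := continuousOn_univ.1 hg.continuousOn
      have hcl : IsClosed (A ∪ ⋃ i ∈ s, g ⁻¹' (B i).cell (r i)) :=
        hA.union (s.finite_toSet.isClosed_biUnion fun i _ =>
          ((B i).isClosed_cell (hr i).le).preimage hgc)
      obtain ⟨h₂, h₂c, h₂h, h₂K, h₂O⟩ := hstep g h₁ _ hg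
        (fun x => (hgK x).imp fun p hp => ⟨hp.1, hOO₁ hp.2⟩) hcl h₁c h₁K h₁O
      have heq : A ∪ ⋃ i ∈ insert j s, g ⁻¹' (B i).cell (r i) =
          (A ∪ ⋃ i ∈ s, g ⁻¹' (B i).cell (r i)) ∪ g ⁻¹' (B j).cell (r j) := by
        rw [Finset.set_biUnion_insert, union_assoc]
        congr 1
        exact union_comm _ _
      rw [heq]
      exact ⟨h₂, h₂c, fun x hx => (h₂h (Or.inl hx)).trans (h₁h hx), h₂K, h₂O⟩
  obtain ⟨O, hO, -, h⟩ := key Finset.univ univ univ_mem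
  refine ⟨O, hO, fun g h₀ A hg hgK hA hh hhK hgh => ?_⟩
  obtain ⟨h', hc, heq, -⟩ := h g h₀ A hg hgK hA hh hhK hgh
  refine ⟨h', hc.mono fun x _ => Or.inr ?_, heq⟩
  obtain ⟨i, hi⟩ := hcov (g x)
  exact mem_iUnion₂.2 ⟨i, Finset.mem_univ i, hi⟩

end Extension

end CodimOneFoliation

namespace CodimOneFoliation

variable {M : Type*} [TopologicalSpace M] [ChartedSpace E3 M] {F : CodimOneFoliation M}

/-! ### Chains of plaques -/

section PlaqueNhd

variable {ι : Type*}

/-- The union of a set with all plaques of the given flow boxes which meet it. -/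
def plaqueNhd (B : ι → F.FlowBox) (K : Set M) : Set M :=
  K ∪ {q | ∃ i, ∃ p ∈ K, (p, q) ∈ (B i).plaqueRel}

theorem plaqueNhd_mono (B : ι → F.FlowBox) : Monotone (plaqueNhd B) := by
  rintro K K' h q (hq | ⟨i, p, hp, hpq⟩)
  exacts [Or.inl (h hq), Or.inr ⟨i, p, h hp, hpq⟩]

theorem subset_plaqueNhd (B : ι → F.FlowBox) (K : Set M) : K ⊆ plaqueNhd B K := subset_union_left

/-- A plaque of a flow box is leaf-compact. -/
theorem FlowBox.isLeafCompact_plaque (B : F.FlowBox) (c : ℝ) :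
    F.IsLeafCompact {p ∈ B.cell B.radius | (B.chart p).2 = c} := by
  have hS : IsCompact {z : ℂ | ‖(z, c)‖ ≤ B.radius} :=
    (isCompact_closedBall (0 : ℂ) B.radius).of_isClosed_subset
      (isClosed_le (by fun_prop) continuous_const)
      fun z hz => mem_closedBall_zero_iff.2 ((norm_fst_le (z, c)).trans hz)
  have hcont : F.LeafContinuousOn (fun z => B.chart.symm (z, c)) {z : ℂ | ‖(z, c)‖ ≤ B.radius} :=
    B.leafContinuousOn_symm (u := fun z => z) (c := fun _ => c) continuousOn_id
      (fun _ _ => Eventually.of_forall fun _ => rfl) fun _ hz => hz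
  have h := @IsCompact.image_of_continuousOn ℂ M _ F.leafTopology _ _ hS hcont
  refine Eq.mp (congrArg _ ?_) h
  ext p
  constructor
  · rintro ⟨z, hz, rfl⟩
    refine ⟨FlowBox.symm_mem_cell hz, ?_⟩
    change (B.chart (B.chart.symm (z, c))).2 = c
    rw [B.chart.right_inv (FlowBox.mem_target hz)]
  · rintro ⟨hp, rfl⟩
    exact ⟨(B.chart p).1, hp.2, B.chart.left_inv hp.1⟩

theorem IsLeafCompact.plaqueNhd [T2Space M] [Finite ι] (B : ι → F.FlowBox) {K : Set M}
    (hK : F.IsLeafCompact K) : F.IsLeafCompact (plaqueNhd B K) := by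
  have h : CodimOneFoliation.plaqueNhd B K = K ∪ ⋃ i,
      ⋃ c ∈ (fun p => ((B i).chart p).2) '' (K ∩ (B i).cell (B i).radius),
        {p ∈ (B i).cell (B i).radius | ((B i).chart p).2 = c} := by
    ext q
    simp only [CodimOneFoliation.plaqueNhd, FlowBox.plaqueRel, mem_union, mem_ofPred_eq, mem_iUnion,
      exists_prop, mem_image, mem_inter_iff]
    refine or_congr_right (exists_congr fun i => ⟨?_, ?_⟩)
    · rintro ⟨p, hp, hpc, hqc, h⟩
      exact ⟨_, ⟨p, ⟨hp, hpc⟩, rfl⟩, hqc, h.symm⟩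
    · rintro ⟨_, ⟨p, ⟨hp, hpc⟩, rfl⟩, hqc, h⟩
      exact ⟨p, hp, hpc, hqc, h.symm⟩
  rw [h]
  exact @IsCompact.union M F.leafTopology _ _ hK (@isCompact_iUnion M F.leafTopology _ _ _ fun i =>
    @Set.Finite.isCompact_biUnion _ _ F.leafTopology _ _ (FlowBox.finite_levels hK le_rfl)
      fun c _ => (B i).isLeafCompact_plaque c)

theorem IsLeafCompact.iterate_plaqueNhd [T2Space M] [Finite ι] (B : ι → F.FlowBox) {K : Set M}
    (hK : F.IsLeafCompact K) (n : ℕ) :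
    F.IsLeafCompact ((CodimOneFoliation.plaqueNhd B)^[n] K) := by
  induction n with
  | zero => exact hK
  | succ n ih => rw [Function.iterate_succ_apply']; exact ih.plaqueNhd B

theorem exists_isOpen_plaqueNhd_subset [T2Space M] [Finite ι] (B : ι → F.FlowBox) {K O' : Set M}
    (hO' : IsOpen O') (hK : plaqueNhd B K ⊆ O') :
    ∃ O, IsOpen O ∧ K ⊆ O ∧ plaqueNhd B O ⊆ O' := by
  let T : ι → Set M := fun i => Prod.fst '' ((B i).plaqueRel ∩ Prod.snd ⁻¹' O'ᶜ)
  have hT : ∀ i, IsClosed (T i) := fun i =>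
    (((FlowBox.isCompact_plaqueRel).inter_right (hO'.isClosed_compl.preimage continuous_snd)).image
      continuous_fst).isClosed
  refine ⟨O' ∩ ⋂ i, (T i)ᶜ, hO'.inter (isOpen_iInter_of_finite fun i => (hT i).isOpen_compl),
    fun p hp => ⟨hK (Or.inl hp), mem_iInter.2 fun i => ?_⟩, ?_⟩
  · rintro ⟨⟨p, q⟩, ⟨hpq, hq⟩, rfl⟩
    exact hq (hK (Or.inr ⟨i, p, hp, hpq⟩))
  · rintro q (hq | ⟨i, p, hp, hpq⟩)
    · exact hq.1
    · by_contra hqO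
      exact mem_iInter.1 hp.2 i ⟨(p, q), ⟨hpq, hqO⟩, rfl⟩

/-- Taking plaque neighbourhoods is upper semicontinuous. -/
theorem exists_isOpen_iterate_plaqueNhd_subset [T2Space M] [Finite ι] (B : ι → F.FlowBox) (n : ℕ)
    {K O' : Set M} (hO' : IsOpen O') (hK : (plaqueNhd B)^[n] K ⊆ O') :
    ∃ O, IsOpen O ∧ K ⊆ O ∧ (plaqueNhd B)^[n] O ⊆ O' := by
  induction n generalizing K with
  | zero => exact ⟨O', hO', hK, subset_rfl⟩
  | succ n ih =>
    rw [Function.iterate_succ_apply] at hK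
    obtain ⟨O₁, hO₁, hKO₁, h₁⟩ := ih hK
    obtain ⟨O, hO, hKO, h⟩ := exists_isOpen_plaqueNhd_subset B hO₁ hKO₁
    exact ⟨O, hO, hKO, by
      rw [Function.iterate_succ_apply]; exact ((plaqueNhd_mono B).iterate n h).trans h₁⟩

end PlaqueNhd

/-! ### Straightened flow boxes -/

/-- In the coordinates `(z, t)` of the flow box and a chart `ψ` of the target, the map is
`(z, t) ↦ γ t + z ^ m`. -/
structure FlowBox.IsStraightened {Y : Type*} [TopologicalSpace Y] (B : F.FlowBox) (π : M → Y)
    (ψ : OpenPartialHomeomorph Y ℂ) (γ : ℝ → ℂ) (m : ℕ) : Prop where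
  ne_zero : m ≠ 0
  mapsTo : MapsTo π B.chart.source ψ.source
  eq : ∀ p ∈ B.chart.source, ψ (π p) = γ (B.chart p).2 + (B.chart p).1 ^ m

section Pieces

variable {Y : Type*} [TopologicalSpace Y] {π : M → Y} {ψ : OpenPartialHomeomorph Y ℂ}
  {γ : ℝ → ℂ} {m : ℕ} {B : F.FlowBox} {r : ℝ}

/-- A connected leafwise piece which starts in a smaller cell stays in one plaque if its image under
`π` is small: as `z ^ m` varies little, `|z|` cannot reach the radius of the box. -/
theorem FlowBox.IsStraightened.plaqueRel_of_isPreconnected [T2Space M]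
    (hB : B.IsStraightened π ψ γ m) (hr : r < B.radius) {X : Type*} [TopologicalSpace X] {S : Set X}
    (hS : IsPreconnected S) {g : X → M} (hg : F.LeafContinuousOn g S) {a : X} (ha : a ∈ S)
    (hga : g a ∈ B.cell r)
    (hsmall : ∀ x ∈ S, ‖ψ (π (g x)) - ψ (π (g a))‖ < B.radius ^ m - r ^ m) {x : X} (hx : x ∈ S) :
    (g a, g x) ∈ B.plaqueRel := by
  have hr0 : 0 ≤ r := (norm_nonneg _).trans hga.2
  have := isPreconnected_iff_preconnectedSpace.1 hS
  let P : Set M := {p ∈ B.cell B.radius | (B.chart p).2 = (B.chart (g a)).2}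
  have hP : IsClosed P :=
    (B.chart.continuousOn.mono fun p hp => hp.1).preimage_isClosed_of_isClosed
      (B.isClosed_cell le_rfl) (isClosed_eq continuous_snd continuous_const)
  have hgS : Continuous (fun x : S => g x) := continuousOn_iff_continuous_domRestrict.1 hg.continuousOn
  have haP : g a ∈ P := ⟨FlowBox.cell_mono hr.le hga, rfl⟩
  have hclopen : IsClopen ((fun x : S => g x) ⁻¹' P) := by
    refine ⟨hP.preimage hgS, isOpen_iff_mem_nhds.2 fun x hxP => ?_⟩
    have h1 : ∀ᶠ y : S in 𝓝 x, g y ∈ B.chart.source :=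
      hgS.continuousAt.eventually (B.chart.open_source.mem_nhds hxP.1.1)
    have h2 : ∀ᶠ y : S in 𝓝 x, (B.chart (g y)).2 = (B.chart (g x)).2 := by
      have := hg.eventually_eq B.adapted x.2 hxP.1.1
      rw [nhdsWithin_eq_map_subtype_coe x.2] at this
      exact this
    filter_upwards [h1, h2] with y hy1 hy2
    have hc : (B.chart (g y)).2 = (B.chart (g a)).2 := hy2.trans hxP.2
    refine ⟨⟨hy1, ?_⟩, hc⟩
    have hd := hsmall y y.2
    rw [hB.eq _ hy1, hB.eq _ hga.1, hc, add_sub_add_left_eq_sub] at hd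
    have hz : ‖(B.chart (g a)).1‖ ^ m ≤ r ^ m :=
      pow_le_pow_left₀ (norm_nonneg _) ((norm_fst_le _).trans hga.2) m
    have hlt : ‖(B.chart (g y)).1‖ ^ m < B.radius ^ m := by
      have := norm_le_norm_add_norm_sub ((B.chart (g a)).1 ^ m) ((B.chart (g y)).1 ^ m)
      rw [norm_sub_rev, norm_pow, norm_pow] at this
      linarith
    rw [Prod.norm_def, hc]
    exact max_le (lt_of_pow_lt_pow_left₀ m B.radius_pos.le hlt).le
      ((norm_snd_le _).trans (hga.2.trans hr.le))
  have huniv := hclopen.eq_univ ⟨⟨a, ha⟩, haP⟩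
  have hxP : g x ∈ P := (huniv ▸ mem_univ (⟨x, hx⟩ : S) : (⟨x, hx⟩ : S) ∈ (fun x : S => g x) ⁻¹' P)
  exact ⟨haP.1, hxP.1, hxP.2.symm⟩

/-- Finitely many straightened flow boxes covering the manifold: near every point of the target
there is an open connected set over which connected leafwise pieces lie in one plaque. -/
theorem exists_isOpen_forall_plaqueRel [T2Space M] [T2Space Y] [LocallyConnectedSpace Y]
    (hπ : Continuous π) {ι : Type*} [Finite ι] (B : ι → F.FlowBox) {r : ι → ℝ}
    (hr0 : ∀ i, 0 ≤ r i) (hr : ∀ i, r i < (B i).radius) (hcov : ∀ p, ∃ i, p ∈ (B i).cell (r i))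
    {ψ : ι → OpenPartialHomeomorph Y ℂ} {γ : ι → ℝ → ℂ} {m : ι → ℕ}
    (hB : ∀ i, (B i).IsStraightened π (ψ i) (γ i) (m i)) (y : Y) :
    ∃ V, IsOpen V ∧ y ∈ V ∧ IsConnected V ∧ ∀ (X : Type) [TopologicalSpace X] (S : Set X)
      (g : X → M), IsPreconnected S → F.LeafContinuousOn g S → MapsTo (fun x => π (g x)) S V →
      ∀ a ∈ S, ∀ x ∈ S, ∃ i, (g a, g x) ∈ (B i).plaqueRel := by
  have hnhd : ∀ i, ∃ N ∈ 𝓝 y, ∀ p ∈ (B i).cell (r i), π p ∈ N → ∀ w ∈ N,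
      ‖ψ i w - ψ i (π p)‖ < (B i).radius ^ m i - r i ^ m i := by
    intro i
    have hδ : 0 < (B i).radius ^ m i - r i ^ m i :=
      sub_pos.2 (pow_lt_pow_left₀ (hr i) (hr0 i) (hB i).ne_zero)
    by_cases hy : y ∈ π '' (B i).cell (r i)
    · obtain ⟨p, hp, rfl⟩ := hy
      have hc := (ψ i).continuousAt ((hB i).mapsTo hp.1)
      refine ⟨_, hc.preimage_mem_nhds (ball_mem_nhds _ (half_pos hδ)), fun q hq hqN w hw => ?_⟩
      have h := dist_triangle_right (ψ i w) (ψ i (π q)) (ψ i (π p))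
      have h1 := mem_ball.1 hqN
      have h2 := mem_ball.1 hw
      rw [← dist_eq_norm]
      linarith
    · have hcl : IsClosed (π '' (B i).cell (r i)) := (((B i).isCompact_cell (hr i).le).image hπ).isClosed
      exact ⟨_, hcl.isOpen_compl.mem_nhds hy, fun p hp hpN => absurd (mem_image_of_mem π hp) hpN⟩
  choose N hN hNB using hnhd
  obtain ⟨V, ⟨hVo, hyV, hVc⟩, hVN⟩ :=
    (LocallyConnectedSpace.open_connected_basis y).mem_iff.1 (iInter_mem.2 hN)
  refine ⟨V, hVo, hyV, hVc, fun X _ S g hS hg hgV a ha x hx => ?_⟩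
  obtain ⟨i, hi⟩ := hcov (g a)
  exact ⟨i, (hB i).plaqueRel_of_isPreconnected (hr i) hS hg ha hi (fun x hx =>
    hNB i _ hi (mem_iInter.1 (hVN (hgV ha)) i) _ (mem_iInter.1 (hVN (hgV hx)) i)) hx⟩

end Pieces

end CodimOneFoliation

/-! ### Pieces of a compact space over a finite cover of the target -/

section PieceChains

variable {X Y : Type*} [TopologicalSpace X]

/-- The union of the components of the sets `f ⁻¹' V k` which meet `A`. -/
def pieceNhd {κ : Type*} (f : X → Y) (V : κ → Set Y) (A : Set X) : Set X :=
  {y | ∃ k, f y ∈ V k ∧ ∃ x ∈ A, x ∈ connectedComponentIn (f ⁻¹' V k) y}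

variable {κ : Type*} {f : X → Y} {V : κ → Set Y}

theorem subset_pieceNhd (hcov : ∀ x, ∃ k, f x ∈ V k) (A : Set X) : A ⊆ pieceNhd f V A := by
  intro x hx
  obtain ⟨k, hk⟩ := hcov x
  exact ⟨k, hk, x, hx, mem_connectedComponentIn hk⟩

variable [TopologicalSpace Y]

/-- A component of the preimage of a connected open set at whose points the map is open covers that
set. -/
theorem subset_image_connectedComponentIn [CompactSpace X] [LocallyConnectedSpace X] [T2Space Y]
    (hf : Continuous f) {V : Set Y} (hVo : IsOpen V) (hV : IsPreconnected V) {x : X}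
    (hx : f x ∈ V) (hopen : ∀ y ∈ connectedComponentIn (f ⁻¹' V) x, 𝓝 (f y) ≤ map f (𝓝 y)) :
    V ⊆ f '' connectedComponentIn (f ⁻¹' V) x := by
  set W := connectedComponentIn (f ⁻¹' V) x with hW
  have hWo : IsOpen W := (hVo.preimage hf).connectedComponentIn
  have hWV : W ⊆ f ⁻¹' V := connectedComponentIn_subset _ _
  have hxW : x ∈ W := mem_connectedComponentIn hx
  refine hV.subset_of_closure_inter_subset ?_ ⟨f x, hx, x, hxW, rfl⟩ ?_
  · rw [isOpen_iff_mem_nhds]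
    rintro _ ⟨y, hy, rfl⟩
    exact hopen y hy (image_mem_map (hWo.mem_nhds hy))
  · rintro v ⟨hv, hvV⟩
    have hcl : IsClosed (f '' closure W) := (isClosed_closure.isCompact.image hf).isClosed
    obtain ⟨y, hy, rfl⟩ := closure_minimal (image_mono subset_closure) hcl hv
    refine ⟨y, ?_, rfl⟩
    have hpre : IsPreconnected (insert y W) :=
      isPreconnected_connectedComponentIn.subset_closure (subset_insert _ _)
        (insert_subset hy subset_closure)
    exact hpre.subset_connectedComponentIn (mem_insert_of_mem _ hxW)
      (insert_subset hvV hWV) (mem_insert _ _)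

theorem eq_univ_of_pieceNhd_subset [PreconnectedSpace X] [LocallyConnectedSpace X]
    (hf : Continuous f) (hV : ∀ k, IsOpen (V k)) (hcov : ∀ x, ∃ k, f x ∈ V k) {A : Set X}
    (hA : A.Nonempty) (h : pieceNhd f V A ⊆ A) : A = univ := by
  refine IsClopen.eq_univ ⟨isOpen_compl_iff.1 (isOpen_iff_mem_nhds.2 fun y hy => ?_),
    isOpen_iff_mem_nhds.2 fun y hy => ?_⟩ hA
  all_goals
    obtain ⟨k, hk⟩ := hcov y
    refine mem_of_superset ((((hV k).preimage hf).connectedComponentIn (x := y)).mem_nhds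
      (mem_connectedComponentIn hk)) fun z hz => ?_
  · exact fun hzA => hy (h ⟨k, hk, z, hzA, hz⟩)
  · have hzk : z ∈ f ⁻¹' V k := connectedComponentIn_subset _ _ hz
    refine h ⟨k, hzk, y, hy, ?_⟩
    rw [← connectedComponentIn_eq hz]
    exact mem_connectedComponentIn hk

/-- If the map is open away from `A`, then a component which does not meet `A` contains one of the
finitely many marked points `f ⁻¹' {q k}`. As new components keep being added until the
space is exhausted, this bounds the length of the chains of components needed to reach `A`. -/
theorem iterate_pieceNhd_eq_univ [CompactSpace X] [PreconnectedSpace X] [LocallyConnectedSpace X]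
    [T2Space Y] [Fintype κ] (hf : Continuous f) (hVo : ∀ k, IsOpen (V k))
    (hV : ∀ k, IsPreconnected (V k)) (hcov : ∀ x, ∃ k, f x ∈ V k) {q : κ → Y}
    (hq : ∀ k, q k ∈ V k) {A : Set X} (hA : A.Nonempty) (hopen : ∀ x ∉ A, 𝓝 (f x) ≤ map f (𝓝 x))
    (hfin : ∀ k, (f ⁻¹' {q k}).Finite) {N : ℕ} (hN : ∑ k, (f ⁻¹' {q k}).ncard ≤ N) :
    (pieceNhd f V)^[N + 1] A = univ := by
  by_contra hne
  let S : ℕ → Set X := fun n => (pieceNhd f V)^[n + 1] A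
  have hSs : ∀ n, S (n + 1) = pieceNhd f V (S n) := fun n => Function.iterate_succ_apply' _ _ _
  have hmono : Monotone S := monotone_nat_of_le_succ fun n => by
    rw [hSs]; exact subset_pieceNhd hcov _
  have hS0 : S 0 = pieceNhd f V A := rfl
  -- each of the first `N + 1` steps adds a component, which contains a marked point
  have hex : ∀ n : Fin (N + 1), ∃ y ∉ S n, ∃ k, f y ∈ V k ∧
      (∃ x ∈ S n, x ∈ connectedComponentIn (f ⁻¹' V k) y) ∧
      ∃ u ∈ connectedComponentIn (f ⁻¹' V k) y, f u = q k := by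
    intro n
    have hn : S n ≠ univ := fun h =>
      hne (univ_subset_iff.1 (h ▸ hmono (Nat.lt_succ_iff.1 n.2)))
    have hAS : A ⊆ S n := (subset_pieceNhd hcov A).trans (hmono (Nat.zero_le n))
    obtain ⟨y, ⟨k, hk, hx⟩, hyS⟩ := not_subset.1 fun h =>
      hn (eq_univ_of_pieceNhd_subset hf hVo hcov (hA.mono hAS) h)
    refine ⟨y, hyS, k, hk, hx, ?_⟩
    exact subset_image_connectedComponentIn hf (hVo k) (hV k) hk (fun z hz => hopen z fun hzA =>
      hyS (hmono (Nat.zero_le n) (hS0 ▸ ⟨k, hk, z, hzA, hz⟩))) (hq k)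
  choose y hyS k hk hx u huW hu using hex
  have := fun k => (hfin k).fintype
  let Φ : Fin (N + 1) → Σ k, (f ⁻¹' {q k} : Set X) := fun n => ⟨k n, u n, hu n⟩
  -- a component is added only once, so the marked points are distinct
  have hlt : ∀ n n', n < n' → Φ n ≠ Φ n' := by
    intro n n' hnn' heq
    have hkk : k n = k n' := congrArg Sigma.fst heq
    have huu : u n = u n' := congrArg (fun z : Σ k, (f ⁻¹' {q k} : Set X) => (z.2 : X)) heq
    obtain ⟨x, hxS, hxW⟩ := hx n
    have hW : connectedComponentIn (f ⁻¹' V (k n)) (y n) =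
        connectedComponentIn (f ⁻¹' V (k n')) (y n') := by
      rw [connectedComponentIn_eq (huW n), connectedComponentIn_eq (huW n'), hkk, huu]
    refine hyS n' (hmono (Nat.succ_le_iff.2 hnn') ?_)
    rw [Nat.succ_eq_add_one, hSs]
    exact ⟨k n', hk n', x, hxS, hW ▸ hxW⟩
  have hinj : Function.Injective Φ := by
    intro n n' h
    rcases lt_trichotomy n n' with hl | hl | hl
    · exact absurd h (hlt _ _ hl)
    · exact hl
    · exact absurd h.symm (hlt _ _ hl)
  have hcard := Fintype.card_le_of_injective Φ hinj
  rw [Fintype.card_fin, Fintype.card_sigma] at hcard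
  have : ∑ k, Fintype.card (f ⁻¹' {q k} : Set X) = ∑ k, (f ⁻¹' {q k}).ncard :=
    Finset.sum_congr rfl fun k _ => by rw [← Nat.card_eq_fintype_card]; rfl
  omega

end PieceChains

/-! ### Counting points in the fibres of a family -/

section FibreCount

variable {T X : Type*} [TopologicalSpace T] [TopologicalSpace X] {Z : Set (T × X)}

theorem finite_fibre [CompactSpace X] (hZ : IsClosed Z)
    (huniq : ∀ z ∈ Z, ∃ U ∈ 𝓝 z.2, ∀ᶠ s in 𝓝 z.1, ∀ a ∈ U, ∀ b ∈ U,
      (s, a) ∈ Z → (s, b) ∈ Z → a = b) (t : T) : {x | (t, x) ∈ Z}.Finite := by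
  have hc : IsCompact {x | (t, x) ∈ Z} :=
    (hZ.preimage (by fun_prop : Continuous fun x : X => (t, x))).isCompact
  choose! U hU hUu using fun x (hx : (t, x) ∈ Z) => huniq (t, x) hx
  obtain ⟨s, hsZ, hs⟩ := hc.elim_nhds_subcover U hU
  refine s.finite_toSet.subset fun x hx => ?_
  obtain ⟨y, hys, hxy⟩ := mem_iUnion₂.1 (hs hx)
  rwa [(hUu y (hsZ y hys)).self_of_nhds x hxy y (mem_of_mem_nhds (hU y (hsZ y hys))) hx
    (hsZ y hys)]

/-- The number of points in the fibres of a closed subset of `T × X`, with `X` compact, is locally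
constant if that subset is locally the graph of a continuous function on `T`. -/
theorem isLocallyConstant_ncard_fibre [CompactSpace X] [T2Space X] (hZ : IsClosed Z)
    (huniq : ∀ z ∈ Z, ∃ U ∈ 𝓝 z.2, ∀ᶠ s in 𝓝 z.1, ∀ a ∈ U, ∀ b ∈ U,
      (s, a) ∈ Z → (s, b) ∈ Z → a = b)
    (hex : ∀ z ∈ Z, ∀ U ∈ 𝓝 z.2, ∀ᶠ s in 𝓝 z.1, ∃ a ∈ U, (s, a) ∈ Z) :
    IsLocallyConstant fun t => {x | (t, x) ∈ Z}.ncard := by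
  rw [IsLocallyConstant.iff_eventually_eq]
  intro t
  have hfin := finite_fibre hZ huniq t
  obtain ⟨D, hD, hDd⟩ := hfin.t2_separation
  choose! U hU hUu using fun x (hx : (t, x) ∈ Z) => huniq (t, x) hx
  let W : X → Set X := fun x => D x ∩ interior (U x)
  have hWo : ∀ x, IsOpen (W x) := fun x => (hD x).2.inter isOpen_interior
  have hWx : ∀ x, (t, x) ∈ Z → x ∈ W x := fun x hx => ⟨(hD x).1, mem_interior_iff_mem_nhds.2 (hU x hx)⟩
  -- nearby fibres have exactly one point in each `W x` and none elsewhere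
  have h1 : ∀ᶠ s in 𝓝 t, ∀ x ∈ {x | (t, x) ∈ Z}, ∀ a ∈ W x, ∀ b ∈ W x,
      (s, a) ∈ Z → (s, b) ∈ Z → a = b := by
    refine (eventually_all_finite hfin).2 fun x hx => ?_
    filter_upwards [hUu x hx] with s hs a ha b hb
    exact hs a (interior_subset ha.2) b (interior_subset hb.2)
  have h2 : ∀ᶠ s in 𝓝 t, ∀ x ∈ {x | (t, x) ∈ Z}, ∃ a ∈ W x, (s, a) ∈ Z :=
    (eventually_all_finite hfin).2 fun x hx => hex (t, x) hx _ ((hWo x).mem_nhds (hWx x hx))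
  have h3 : ∀ᶠ s in 𝓝 t, ∀ a, (s, a) ∈ Z → ∃ x, (t, x) ∈ Z ∧ a ∈ W x := by
    let E : Set (T × X) := Z ∩ Prod.snd ⁻¹' (⋃ x ∈ {x | (t, x) ∈ Z}, W x)ᶜ
    have hE : IsClosed (Prod.fst '' E) := isClosedMap_fst_of_compactSpace _
      (hZ.inter ((isOpen_biUnion fun x _ => hWo x).isClosed_compl.preimage continuous_snd))
    have htE : t ∉ Prod.fst '' E := by
      rintro ⟨⟨t', x⟩, ⟨hx, hxW⟩, rfl⟩
      exact hxW (mem_iUnion₂.2 ⟨x, hx, hWx x hx⟩)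
    filter_upwards [hE.isOpen_compl.mem_nhds htE] with s hs a ha
    by_contra hcon
    refine hs ⟨(s, a), ⟨ha, fun haW => hcon ?_⟩, rfl⟩
    obtain ⟨x, hx, hax⟩ := mem_iUnion₂.1 haW
    exact ⟨x, hx, hax⟩
  filter_upwards [h1, h2, h3] with s h1 h2 h3
  choose! v hvW hvZ using h2
  symm
  refine ncard_congr (fun x _ => v x) (fun x hx => hvZ x hx) ?_ ?_
  · intro x x' hx hx' hv
    by_contra hne
    exact disjoint_left.1 (hDd hx hx' hne) (hvW x hx).1 (by
      have := (hvW x' hx').1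
      rwa [← hv] at this)
  · intro a ha
    obtain ⟨x, hx, hax⟩ := h3 a ha
    exact ⟨x, hx, h1 x hx _ (hvW x hx) a hax (hvZ x hx) ha⟩

end FibreCount

/-! ### The projective line -/

namespace CP1

/-- The entries of the orthogonal projection onto the line spanned by a vector. -/
noncomputable def projEntry (v : {v : Fin 2 → ℂ // v ≠ 0}) (i j : Fin 2) : ℂ :=
  v.1 i * star (v.1 j) / (∑ k, v.1 k * star (v.1 k))

open scoped ComplexOrder in
theorem sum_mul_star_ne_zero (v : {v : Fin 2 → ℂ // v ≠ 0}) : ∑ k, v.1 k * star (v.1 k) ≠ 0 :=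
  fun h => v.2 (dotProduct_self_star_eq_zero.1 h)

theorem continuous_projEntry : Continuous projEntry :=
  continuous_pi fun i => continuous_pi fun j => by
    have h : ∀ k, Continuous fun v : {v : Fin 2 → ℂ // v ≠ 0} => v.1 k := fun k =>
      (continuous_apply k).comp continuous_subtype_val
    exact ((h i).mul (h j).star).div (continuous_finsetSum _ fun k _ => (h k).mul (h k).star)
      sum_mul_star_ne_zero

theorem projEntry_eq_iff (v w : {v : Fin 2 → ℂ // v ≠ 0}) :
    projEntry v = projEntry w ↔ mk v = mk w := by
  rw [mk_eq_mk_iff]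
  constructor
  · intro h
    obtain ⟨j, hj⟩ := Function.ne_iff.1 v.2
    have hj' : star (v.1 j) ≠ 0 := star_ne_zero.2 hj
    refine ⟨star (w.1 j) / (∑ k, w.1 k * star (w.1 k)) *
      ((∑ k, v.1 k * star (v.1 k)) / star (v.1 j)), ?_⟩
    funext i
    have hij : v.1 i * star (v.1 j) / (∑ k, v.1 k * star (v.1 k)) =
      w.1 i * star (w.1 j) / (∑ k, w.1 k * star (w.1 k)) := congrFun (congrFun h i) j
    have hv := sum_mul_star_ne_zero v
    calc _ = w.1 i * star (w.1 j) / (∑ k, w.1 k * star (w.1 k)) *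
          ((∑ k, v.1 k * star (v.1 k)) / star (v.1 j)) := by
            rw [Pi.smul_apply, smul_eq_mul]; ring
      _ = v.1 i := by rw [← hij]; field_simp
  · rintro ⟨a, ha⟩
    have ha0 : a ≠ 0 := scalar_ne_zero ha.symm
    have ha0' : star a ≠ 0 := star_ne_zero.2 ha0
    have hw := sum_mul_star_ne_zero w
    funext i j
    have hsum : ∑ k, v.1 k * star (v.1 k) = a * star a * ∑ k, w.1 k * star (w.1 k) := by
      rw [← ha, Finset.mul_sum]
      refine Finset.sum_congr rfl fun k _ => ?_
      simp only [Pi.smul_apply, smul_eq_mul, star_mul']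
      ring
    unfold projEntry
    rw [hsum, ← ha]
    simp only [Pi.smul_apply, smul_eq_mul, star_mul']
    field_simp

instance : T2Space CP1 := by
  let Φ : CP1 → Fin 2 → Fin 2 → ℂ := Quotient.lift (s := projectivizationSetoid ℂ (Fin 2 → ℂ))
    projEntry fun v w h => (projEntry_eq_iff v w).2 (Quotient.sound h)
  have hΦ : ∀ v, Φ (mk v) = projEntry v := fun v => rfl
  refine T2Space.of_injective_continuous (f := Φ) ?_ ?_
  · intro p q h
    obtain ⟨v, rfl⟩ := mk_surjective p
    obtain ⟨w, rfl⟩ := mk_surjective q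
    rw [hΦ, hΦ] at h
    exact (projEntry_eq_iff v w).1 h
  · exact isQuotientMap_mk.continuous_iff.2 continuous_projEntry

instance : LocallyConnectedSpace CP1 := ChartedSpace.locallyConnectedSpace ℂ CP1

/-- Countably many differentiable curves do not fill a nonempty open set. -/
theorem exists_mem_forall_notMem_image {ι : Type*} [Countable ι] {s : ι → Set ℝ} {β : ι → ℝ → CP1}
    (hβ : ∀ n, ∀ t ∈ s n, MDifferentiableAt 𝓘(ℝ, ℝ) 𝓘(ℝ, ℂ) (β n) t) {V : Set CP1}
    (hV : IsOpen V) (hne : V.Nonempty) : ∃ q ∈ V, ∀ n, q ∉ β n '' s n := by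
  obtain ⟨w, hw⟩ := hne
  let χ := chartAt ℂ w
  have hE : IsOpen (χ.target ∩ χ.symm ⁻¹' V) := χ.isOpen_inter_preimage_symm hV
  have hEne : (χ.target ∩ χ.symm ⁻¹' V).Nonempty :=
    ⟨χ w, χ.map_source (mem_chart_source ℂ w), by
      change χ.symm (χ w) ∈ V
      rwa [χ.left_inv (mem_chart_source ℂ w)]⟩
  let A : ι → Set ℂ := fun n => {z | z.im = 0 ∧ z.re ∈ s n ∧ β n z.re ∈ χ.source}
  have hline : MeasureTheory.volume {z : ℂ | z.im = 0} = 0 := by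
    have h := MeasureTheory.Measure.addHaar_submodule MeasureTheory.volume
      (LinearMap.ker Complex.imLm) (fun h => by
        have : Complex.I ∈ LinearMap.ker Complex.imLm := h ▸ Submodule.mem_top
        simp at this)
    exact h
  have hnull : MeasureTheory.volume (⋃ n, (fun z : ℂ => χ (β n z.re)) '' A n) = 0 := by
    refine MeasureTheory.measure_iUnion_null fun n => ?_
    refine MeasureTheory.addHaar_image_eq_zero_of_differentiableOn_of_addHaar_eq_zero _ ?_
      (MeasureTheory.measure_mono_null (fun z hz => hz.1) hline)
    intro z hz
    have h1 : MDifferentiableAt 𝓘(ℝ, ℝ) 𝓘(ℝ, ℂ) (χ ∘ β n) z.re :=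
      (mdifferentiableAt_atlas (chart_mem_atlas ℂ w) hz.2.2).comp z.re (hβ n _ hz.2.1)
    exact ((mdifferentiableAt_iff_differentiableAt.1 h1).comp z
      Complex.reCLM.differentiableAt).differentiableWithinAt
  obtain ⟨y, ⟨hyt, hyV⟩, hy⟩ : ((χ.target ∩ χ.symm ⁻¹' V) \
      ⋃ n, (fun z : ℂ => χ (β n z.re)) '' A n).Nonempty := by
    by_contra hcon
    rw [not_nonempty_iff_eq_empty, sdiff_eq_empty] at hcon
    exact (hE.measure_pos MeasureTheory.volume hEne).ne'
      (MeasureTheory.measure_mono_null hcon hnull)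
  refine ⟨χ.symm y, hyV, ?_⟩
  rintro n ⟨t, ht, hty⟩
  refine hy (mem_iUnion.2 ⟨n, (t : ℂ), ⟨Complex.ofReal_im t, by simpa using ht, ?_⟩, ?_⟩)
  · simpa [hty] using χ.map_target hyt
  · simp [hty, χ.right_inv hyt]

/-- A holomorphic chart of the projective line is a smooth real chart. -/
theorem mem_maximalAtlas_real {ψ : OpenPartialHomeomorph CP1 ℂ}
    (hψ : ψ ∈ IsManifold.maximalAtlas 𝓘(ℂ, ℂ) ω CP1) :
    ψ ∈ IsManifold.maximalAtlas 𝓘(ℝ, ℂ) ∞ CP1 := by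
  refine StructureGroupoid.maximalAtlas_mono (G := contDiffGroupoid ω 𝓘(ℂ, ℂ)) ?_ hψ
  intro e he
  have he := mem_groupoid_of_pregroupoid.1 he
  refine mem_groupoid_of_pregroupoid.2 ?_
  constructor
  · simpa [contDiffPregroupoid] using
      (he.1.restrict_scalars ℝ).of_le le_top
  · simpa [contDiffPregroupoid] using (he.2.restrict_scalars ℝ).of_le le_top

end CP1

/-! ### Differentials of foliated maps -/

/-- A map between spaces of the same dimension is a chart near a point at which its differential is
injective. -/
theorem ContDiffAt.exists_openPartialHomeomorph {E F : Type*} [NormedAddCommGroup E]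
    [NormedSpace ℝ E] [FiniteDimensional ℝ E] [NormedAddCommGroup F] [NormedSpace ℝ F]
    [FiniteDimensional ℝ F] (hEF : Module.finrank ℝ E = Module.finrank ℝ F) {f : E → F} {a : E}
    (hf : ContDiffAt ℝ 1 f a) (hinj : ∀ v, fderiv ℝ f a v = 0 → v = 0) :
    ∃ θ : OpenPartialHomeomorph E F, a ∈ θ.source ∧ ⇑θ = f := by
  have := FiniteDimensional.complete ℝ E
  let T : E ≃L[ℝ] F := (LinearEquiv.ofInjectiveOfFinrankEq (fderiv ℝ f a).toLinearMap
    ((injective_iff_map_eq_zero (fderiv ℝ f a)).2 hinj) hEF).toContinuousLinearEquiv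
  have hT : HasFDerivAt f (T : E →L[ℝ] F) a := (hf.differentiableAt one_ne_zero).hasFDerivAt
  exact ⟨hf.toOpenPartialHomeomorph f hT one_ne_zero,
    hf.mem_toOpenPartialHomeomorph_source hT one_ne_zero, rfl⟩

/-- Openness at a point can be checked in a chart of the target. -/
theorem OpenPartialHomeomorph.nhds_le_map_of_comp {X Y Z : Type*} [TopologicalSpace X]
    [TopologicalSpace Y] [TopologicalSpace Z] (χ : OpenPartialHomeomorph Y Z) {f : X → Y} {x : X}
    (hf : ContinuousAt f x) (hx : f x ∈ χ.source)
    (h : 𝓝 (χ (f x)) ≤ map (fun y => χ (f y)) (𝓝 x)) : 𝓝 (f x) ≤ map f (𝓝 x) := by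
  have h1 : 𝓝 (f x) = map χ.symm (𝓝 (χ (f x))) := by
    rw [χ.symm_map_nhds_eq hx]
  rw [h1]
  refine (map_mono h).trans (le_of_eq ?_)
  rw [map_map]
  refine map_congr ?_
  filter_upwards [hf.eventually (χ.open_source.mem_nhds hx)] with y hy using χ.left_inv hy

/-- The identification of real three-space with `ℂ × ℝ`. -/
noncomputable def E3.equivProd : E3 ≃L[ℝ] ℂ × ℝ :=
  LinearEquiv.toContinuousLinearEquiv
    { toFun := fun y => (⟨y 0, y 1⟩, y 2)
      invFun := fun w => !₂[w.1.re, w.1.im, w.2]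
      map_add' := fun _ _ => rfl
      map_smul' := fun a y => Prod.ext (Complex.ext (by simp) (by simp)) (by simp)
      left_inv := fun y => by ext i; fin_cases i <;> simp
      right_inv := fun w => by simp }

section

variable {M : Type*} [TopologicalSpace M] [ChartedSpace E3 M] [IsManifold (𝓡 3) ∞ M]

theorem mdifferentiable_of_mem_maximalAtlas {H : Type*} [NormedAddCommGroup H] [NormedSpace ℝ H]
    {N : Type*} [TopologicalSpace N] [ChartedSpace H N] [IsManifold 𝓘(ℝ, H) ∞ N]
    {e : OpenPartialHomeomorph N H} (he : e ∈ IsManifold.maximalAtlas 𝓘(ℝ, H) ∞ N) :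
    e.MDifferentiable 𝓘(ℝ, H) 𝓘(ℝ, H) :=
  ⟨(contMDiffOn_of_mem_maximalAtlas he).mdifferentiableOn (by simp),
    (contMDiffOn_symm_of_mem_maximalAtlas he).mdifferentiableOn (by simp)⟩

namespace CodimOneFoliation

variable {F : CodimOneFoliation M}

theorem mdifferentiableAt_transverse {e : OpenPartialHomeomorph M E3}
    (he : e ∈ IsManifold.maximalAtlas (𝓡 3) ∞ M) {p : M} (hp : p ∈ e.source) :
    MDifferentiableAt (𝓡 3) 𝓘(ℝ, ℝ) (fun q => e q 2) p :=
  (EuclideanSpace.proj (2 : Fin 3) : E3 →L[ℝ] ℝ).differentiableAt.mdifferentiableAt.comp p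
    ((mdifferentiable_of_mem_maximalAtlas he).mdifferentiableAt hp)

/-- The differential of a map takes its values in the tangent plane of the foliation where the
transverse coordinates are constant along the map. -/
theorem mfderiv_mem_tangentPlane {E : Type*} [NormedAddCommGroup E] [NormedSpace ℝ E] {g : E → M}
    {x : E} (hg : MDifferentiableAt 𝓘(ℝ, E) (𝓡 3) g x)
    (hleaf : ∀ e ∈ F.charts, g x ∈ e.source → ∀ᶠ y in 𝓝 x, e (g y) 2 = e (g x) 2) (v : E) :
    mfderiv 𝓘(ℝ, E) (𝓡 3) g x v ∈ F.tangentPlane (g x) := by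
  intro e he hp
  have h := mfderiv_comp x (mdifferentiableAt_transverse (F.charts_subset he) hp) hg
  have h0 : mfderiv 𝓘(ℝ, E) 𝓘(ℝ, ℝ) ((fun q => e q 2) ∘ g) x = 0 := by
    have hev : ((fun q => e q 2) ∘ g) =ᶠ[𝓝 x] fun _ => e (g x) 2 := hleaf e he hp
    rw [hev.mfderiv_eq, mfderiv_const]
  rw [h0] at h
  exact (DFunLike.congr_fun h v).symm

/-- In the coordinates of a foliated chart, vectors without transverse component are tangent to the
foliation. -/
theorem mfderiv_symm_mem_tangentPlane {e : OpenPartialHomeomorph M E3} (he : e ∈ F.charts) {p : M}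
    (hp : p ∈ e.source) {v : E3} (hv : v 2 = 0) :
    mfderiv (𝓡 3) (𝓡 3) e.symm (e p) v ∈ F.tangentPlane (e.symm (e p)) := by
  intro e' he' hp'
  have hed := mdifferentiable_of_mem_maximalAtlas (F.charts_subset he)
  have hsymm := hed.mdifferentiableAt_symm (e.map_source hp)
  have htr := mdifferentiableAt_transverse (F.charts_subset he') hp'
  have h := mfderiv_comp (e p) htr hsymm
  have hd : DifferentiableAt ℝ ((fun q => e' q 2) ∘ e.symm) (e p) :=
    mdifferentiableAt_iff_differentiableAt.1 (htr.comp (e p) hsymm)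
  have h0 : fderiv ℝ ((fun q => e' q 2) ∘ e.symm) (e p) v = 0 := by
    rw [← hd.lineDeriv_eq_fderiv]
    rw [e.left_inv hp] at hp'
    obtain ⟨U, hU, hUc⟩ := F.compatible e he e' he' p ⟨hp, hp'⟩
    have hline : Tendsto (fun s : ℝ => e p + s • v) (𝓝 0) (𝓝 (e p)) := by
      have : Continuous fun s : ℝ => e p + s • v := by fun_prop
      simpa using this.tendsto 0
    have hsymm0 : Tendsto e.symm (𝓝 (e p)) (𝓝 p) := by
      simpa [ContinuousAt, e.left_inv hp] using e.continuousAt_symm (e.map_source hp)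
    have hev : (fun s : ℝ => ((fun q => e' q 2) ∘ e.symm) (e p + s • v)) =ᶠ[𝓝 0]
        fun _ => e' p 2 := by
      filter_upwards [(hsymm0.comp hline).eventually hU,
        hline.eventually (e.open_target.mem_nhds (e.map_source hp))] with s hs hst
      refine (hUc _ hs p (mem_of_mem_nhds hU)).1 ?_
      change e (e.symm (e p + s • v)) 2 = e p 2
      rw [e.right_inv hst]
      simp [hv]
    rw [lineDeriv, hev.deriv_eq, deriv_const]
  rw [← mfderiv_eq_fderiv, h] at h0
  exact h0

end CodimOneFoliation

end

/-! ### Straightening charts for a foliated branched cover -/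

section

variable {M : Type*} [TopologicalSpace M]

/-- The coordinates `(z, t)` of a chart, with `z = x + i y`. -/
noncomputable def OpenPartialHomeomorph.toProd (e : OpenPartialHomeomorph M E3) :
    OpenPartialHomeomorph M (ℂ × ℝ) := e.transHomeomorph E3.equivProd.toHomeomorph

theorem OpenPartialHomeomorph.toProd_apply (e : OpenPartialHomeomorph M E3) (p : M) :
    e.toProd p = (plaqueCoord e p, e p 2) := rfl

variable [ChartedSpace E3 M]

namespace CodimOneFoliation

variable {F : CodimOneFoliation M} {π : M → CP1}

theorem IsFoliatedChart.isAdapted {e : OpenPartialHomeomorph M E3} (he : F.IsFoliatedChart e) :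
    F.IsAdapted e.toProd := fun e' he' p hp => he.2 e' he' p hp

/-- A straightening chart centred at a point restricts to a flow box. -/
theorem exists_flowBox {φ : OpenPartialHomeomorph M (ℂ × ℝ)} (hφ : F.IsAdapted φ) {p : M}
    (hp : p ∈ φ.source) (hp0 : φ p = 0) {ψ : OpenPartialHomeomorph CP1 ℂ} {γ : ℝ → ℂ} {m : ℕ}
    (hm : m ≠ 0) (hmaps : MapsTo π φ.source ψ.source)
    (heq : ∀ q ∈ φ.source, ψ (π q) = γ (φ q).2 + (φ q).1 ^ m) :
    ∃ B : F.FlowBox, B.IsStraightened π ψ γ m ∧ B.cell (B.radius / 2) ∈ 𝓝 p := by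
  obtain ⟨ρ, hρ, hρt⟩ := Metric.nhds_basis_closedBall.mem_iff.1
    (φ.open_target.mem_nhds (hp0 ▸ φ.map_source hp))
  refine ⟨⟨φ, ρ, hφ, hρ, hρt⟩, ⟨hm, hmaps, heq⟩, ?_⟩
  have h : ∀ᶠ q in 𝓝 p, ‖φ q‖ < ρ / 2 := by
    refine (φ.continuousAt hp).norm.eventually_lt continuousAt_const ?_
    rw [hp0, norm_zero]
    exact half_pos hρ
  filter_upwards [h, φ.open_source.mem_nhds hp] with q hq hqs using ⟨hqs, hq.le⟩

variable [IsManifold (𝓡 3) ∞ M]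

/-- Near a regular point, `π` and the transverse coordinate together form a chart. -/
theorem exists_flowBox_of_notMem_criticalSet (hπ : IsFoliatedBranchedCover F π) {p : M}
    (hp : p ∉ criticalSet π) :
    ∃ (B : F.FlowBox) (ψ : OpenPartialHomeomorph CP1 ℂ) (γ : ℝ → ℂ) (m : ℕ),
      B.IsStraightened π ψ γ m ∧ B.cell (B.radius / 2) ∈ 𝓝 p := by
  obtain ⟨e, he, hpe⟩ := F.covers p
  have heA := F.charts_subset he
  let χ := chartAt ℂ (π p)
  have hχs : π p ∈ χ.source := mem_chart_source ℂ (π p)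
  have hχ : χ ∈ IsManifold.maximalAtlas 𝓘(ℝ, ℂ) ∞ CP1 := IsManifold.chart_mem_maximalAtlas _
  have hed := mdifferentiable_of_mem_maximalAtlas heA
  have hχd := mdifferentiable_of_mem_maximalAtlas hχ
  have hmem := e.map_source hpe
  have hinv := e.left_inv hpe
  have hsm : ContMDiffAt (𝓡 3) 𝓘(ℝ, ℂ) ∞ (χ ∘ π ∘ e.symm) (e p) := by
    refine ContMDiffAt.comp (e p) (g := χ) (I' := 𝓘(ℝ, ℂ)) ?_ (ContMDiffAt.comp (e p) (I' := 𝓡 3)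
      (hπ.smooth _) (contMDiffAt_symm_of_mem_maximalAtlas heA hmem))
    refine contMDiffAt_of_mem_maximalAtlas hχ ?_
    simpa [hinv] using hχs
  have hf : ContDiffAt ℝ 1 (fun y : E3 => ((χ ∘ π ∘ e.symm) y, y 2)) (e p) :=
    ((contMDiffAt_iff_contDiffAt.1 hsm).of_le (by norm_cast)).prodMk
      (EuclideanSpace.proj (2 : Fin 3) : E3 →L[ℝ] ℝ).contDiff.contDiffAt
  have hf1 : DifferentiableAt ℝ (χ ∘ π ∘ e.symm) (e p) :=
    (contMDiffAt_iff_contDiffAt.1 hsm).differentiableAt (by simp)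
  have hinj : ∀ v, fderiv ℝ (fun y : E3 => ((χ ∘ π ∘ e.symm) y, y 2)) (e p) v = 0 → v = 0 := by
    intro v hv
    have hD : HasFDerivAt (fun y : E3 => ((χ ∘ π ∘ e.symm) y, y 2))
        ((fderiv ℝ (χ ∘ π ∘ e.symm) (e p)).prod (EuclideanSpace.proj (2 : Fin 3) : E3 →L[ℝ] ℝ))
        (e p) := hf1.hasFDerivAt.prodMk (EuclideanSpace.proj (2 : Fin 3) : E3 →L[ℝ] ℝ).hasFDerivAt
    rw [hD.fderiv] at hv
    obtain ⟨hv1, hv2⟩ := Prod.ext_iff.1 hv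
    replace hv1 : fderiv ℝ (χ ∘ π ∘ e.symm) (e p) v = 0 := hv1
    replace hv2 : v 2 = 0 := hv2
    have hsymm := hed.mdifferentiableAt_symm hmem
    have hπd : MDifferentiableAt (𝓡 3) 𝓘(ℝ, ℂ) π (e.symm (e p)) :=
      (hπ.smooth _).mdifferentiableAt (by simp)
    have hχs' : π (e.symm (e p)) ∈ χ.source := by simpa [hinv] using hχs
    have hc := mfderiv_comp (e p) (hχd.mdifferentiableAt hχs') (hπd.comp (e p) hsymm)
    have hc' := mfderiv_comp (e p) hπd hsymm
    rw [← mfderiv_eq_fderiv] at hv1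
    have h0 : mfderiv (𝓡 3) 𝓘(ℝ, ℂ) π (e.symm (e p)) (mfderiv (𝓡 3) (𝓡 3) e.symm (e p) v) = 0 := by
      have h1 : mfderiv 𝓘(ℝ, ℂ) 𝓘(ℝ, ℂ) χ (π (e.symm (e p)))
          (mfderiv (𝓡 3) 𝓘(ℝ, ℂ) (π ∘ e.symm) (e p) v) = 0 :=
        (DFunLike.congr_fun hc v).symm.trans hv1
      have h2 := (injective_iff_map_eq_zero _).1 (hχd.mfderiv_injective hχs') _ h1
      exact (DFunLike.congr_fun hc' v).symm.trans h2
    have h3 := hπ.leafwise_regular (e.symm (e p)) (by rwa [hinv]) _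
      (mfderiv_symm_mem_tangentPlane he hpe hv2) h0
    exact (injective_iff_map_eq_zero _).1 (hed.symm.mfderiv_injective hmem) _ h3
  obtain ⟨θ, hθs, hθ⟩ := hf.exists_openPartialHomeomorph
    E3.equivProd.toLinearEquiv.finrank_eq hinj
  -- the chart `(χ ∘ π, t)`, translated so that it is centred at `p`
  let φ₀ : OpenPartialHomeomorph M (ℂ × ℝ) :=
    (e.trans θ).restrOpen (π ⁻¹' χ.source) (χ.open_source.preimage hπ.smooth.continuous)
  let φ := φ₀.transHomeomorph (Homeomorph.addRight (-φ₀ p))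
  have hφ₀ : ∀ q ∈ φ.source, φ₀ q = (χ (π q), e q 2) := by
    intro q hq
    have : φ₀ q = θ (e q) := rfl
    rw [this, hθ]
    change (χ (π (e.symm (e q))), e q 2) = _
    rw [e.left_inv hq.1.1]
  have hps : p ∈ φ.source := ⟨⟨hpe, hθs⟩, hχs⟩
  have hφq : ∀ q ∈ φ.source, φ q = (χ (π q) - χ (π p), e q 2 - e p 2) := by
    intro q hq
    have : φ q = φ₀ q + -φ₀ p := rfl
    rw [this, hφ₀ q hq, hφ₀ p hps, ← sub_eq_add_neg, Prod.mk_sub_mk]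
  have hφA : F.IsAdapted φ := by
    intro e' he' q hq
    obtain ⟨U, hU, hUc⟩ := F.compatible e he e' he' q ⟨hq.1.1.1, hq.2⟩
    refine ⟨U ∩ φ.source, inter_mem hU (φ.open_source.mem_nhds hq.1), fun a ha b hb => ?_⟩
    rw [hφq a ha.2, hφq b hb.2, ← hUc a ha.1 b hb.1]
    exact sub_left_inj
  obtain ⟨B, hB⟩ := exists_flowBox hφA hps (by simp [hφq p hps]) (ψ := χ) (π := π)
    (γ := fun _ => χ (π p)) one_ne_zero (fun q hq => hq.2) fun q hq => by simp [hφq q hq]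
  exact ⟨B, χ, _, 1, hB⟩

theorem exists_flowBox_isStraightened (hπ : IsFoliatedBranchedCover F π) (p : M) :
    ∃ (B : F.FlowBox) (ψ : OpenPartialHomeomorph CP1 ℂ) (γ : ℝ → ℂ) (m : ℕ),
      B.IsStraightened π ψ γ m ∧ B.cell (B.radius / 2) ∈ 𝓝 p := by
  by_cases hp : p ∈ criticalSet π
  · obtain ⟨e, ψ, -, γ, he, hpe, hp0, hmaps, -, heq⟩ := hπ.local_model p hp
    have h0 : e.toProd p = 0 := by
      rw [e.toProd_apply, plaqueCoord, hp0]
      exact Prod.ext (Complex.ext rfl rfl) rfl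
    obtain ⟨B, hB⟩ := exists_flowBox he.isAdapted hpe h0 two_ne_zero hmaps heq
    exact ⟨B, ψ, γ, 2, hB⟩
  · exact exists_flowBox_of_notMem_criticalSet hπ hp

/-- In the local model, critical points lie on the axis `z = 0`. -/
theorem plaqueCoord_eq_zero_of_mem_criticalSet (hπ : IsFoliatedBranchedCover F π)
    {e : OpenPartialHomeomorph M E3} (he : e ∈ IsManifold.maximalAtlas (𝓡 3) ∞ M)
    {ψ : OpenPartialHomeomorph CP1 ℂ} (hψ : ψ ∈ IsManifold.maximalAtlas 𝓘(ℝ, ℂ) ∞ CP1)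
    (hmaps : MapsTo π e.source ψ.source) {γ : ℝ → ℂ} (hγ : ContDiff ℝ ∞ γ)
    (heq : ∀ p ∈ e.source, ψ (π p) = γ (e p 2) + plaqueCoord e p ^ 2) {p : M} (hpe : p ∈ e.source)
    (hp : p ∈ criticalSet π) : plaqueCoord e p = 0 := by
  by_contra hz
  refine hp fun u => ?_
  have hed := mdifferentiable_of_mem_maximalAtlas he
  have hψd := mdifferentiable_of_mem_maximalAtlas hψ
  have hmem := e.map_source hpe
  have hπd : MDifferentiableAt (𝓡 3) 𝓘(ℝ, ℂ) π p := (hπ.smooth _).mdifferentiableAt (by simp)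
  have hψp := hψd.mdifferentiableAt (hmaps hpe)
  -- the local expression in the coordinates `(z, t)`
  let Z : E3 →L[ℝ] ℂ := (ContinuousLinearMap.fst ℝ ℂ ℝ).comp (E3.equivProd : E3 →L[ℝ] ℂ × ℝ)
  let T : E3 →L[ℝ] ℝ := (ContinuousLinearMap.snd ℝ ℂ ℝ).comp (E3.equivProd : E3 →L[ℝ] ℂ × ℝ)
  let Q : E3 → ℂ := fun y => γ (T y) + Z y ^ 2
  have hQ : HasFDerivAt Q ((fderiv ℝ γ (T (e p))).comp T + (2 * Z (e p)) • Z) (e p) := by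
    have h1 : HasFDerivAt (fun y => γ (T y)) ((fderiv ℝ γ (T (e p))).comp T) (e p) :=
      ((hγ.differentiable (by simp)) (T (e p))).hasFDerivAt.comp (e p) T.hasFDerivAt
    have h2 := (Z.hasFDerivAt (x := e p)).pow 2
    refine (h1.add h2).congr_fderiv ?_
    simp
  have hev : (ψ ∘ π) =ᶠ[𝓝 p] (Q ∘ e) := by
    filter_upwards [e.open_source.mem_nhds hpe] with q hq using heq q hq
  have hQd : MDifferentiableAt (𝓡 3) 𝓘(ℝ, ℂ) Q (e p) := hQ.differentiableAt.mdifferentiableAt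
  have hD := hev.mfderiv_eq (I := 𝓡 3) (I' := 𝓘(ℝ, ℂ))
  rw [mfderiv_comp p hψp hπd, mfderiv_comp p hQd (hed.mdifferentiableAt hpe)] at hD
  let c : ℂ := mfderiv 𝓘(ℝ, ℂ) 𝓘(ℝ, ℂ) ψ (π p) u
  obtain ⟨v, hv⟩ := hed.mfderiv_surjective hpe (E3.equivProd.symm ((2 * Z (e p))⁻¹ * c, 0))
  have hZ : ∀ w, Z (E3.equivProd.symm w) = w.1 := fun w => by simp [Z]
  have hT : ∀ w, T (E3.equivProd.symm w) = w.2 := fun w => by simp [T]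
  have hz' : Z (e p) ≠ 0 := hz
  have key : ((fderiv ℝ γ (T (e p))).comp T + (2 * Z (e p)) • Z)
      (E3.equivProd.symm ((2 * Z (e p))⁻¹ * c, 0)) = c := by
    rw [add_apply, ContinuousLinearMap.comp_apply, smul_apply, hT, hZ, map_zero,
      zero_add, smul_eq_mul]
    exact mul_inv_cancel_left₀ (mul_ne_zero two_ne_zero hz') _
  refine ⟨v, hψd.mfderiv_injective (hmaps hpe) ((DFunLike.congr_fun hD v).trans ?_)⟩
  change mfderiv (𝓡 3) 𝓘(ℝ, ℂ) Q (e p) (mfderiv (𝓡 3) (𝓡 3) e p v) = _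
  rw [hv, mfderiv_eq_fderiv, hQ.fderiv]
  exact key

end CodimOneFoliation

end

/-! ### Leafwise immersions composed with the branched cover -/

section

variable {M : Type*} [TopologicalSpace M] [ChartedSpace E3 M] [IsManifold (𝓡 3) ∞ M]

namespace CodimOneFoliation

variable {F : CodimOneFoliation M} {π : M → CP1}

/-- Every nonempty open set contains a point which is neither a critical value nor on the image of a
given smooth closed curve: the critical values lie on countably many smooth curves `γ`. -/
theorem exists_mem_notMem_criticalValues [SecondCountableTopology M]
    (hπ : IsFoliatedBranchedCover F π) {gb : Circle → M} (hgb : ContMDiff (𝓡 1) (𝓡 3) ∞ gb)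
    {V : Set CP1} (hV : IsOpen V) (hne : V.Nonempty) :
    ∃ q ∈ V, (∀ p, π p = q → p ∉ criticalSet π) ∧ ∀ z, π (gb z) ≠ q := by
  choose e ψ hψ γ he hxe he0 hmaps hγ heq using
    fun x : criticalSet π => hπ.local_model x x.2
  obtain ⟨C, hCc, hcov⟩ := TopologicalSpace.countable_cover_nhds fun x : criticalSet π =>
    continuousAt_subtype_val.preimage_mem_nhds ((e x).open_source.mem_nhds (hxe x))
  have := hCc.to_subtype
  -- the countable family of curves: `none` is the closed curve, the others are the curves `γ`
  let β : Option C → ℝ → CP1 := fun o => o.elim (fun s => π (gb (Circle.exp s)))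
    fun x s => (ψ x).symm (γ x s)
  let S : Option C → Set ℝ := fun o => o.elim univ fun x => γ x ⁻¹' (ψ x).target
  have hβ : ∀ o, ∀ s ∈ S o, MDifferentiableAt 𝓘(ℝ, ℝ) 𝓘(ℝ, ℂ) (β o) s := by
    rintro (_ | x) s hs
    · exact (((hπ.smooth.comp hgb).comp contMDiff_circleExp).mdifferentiable (by simp)) s
    · have h1 := (mdifferentiable_of_mem_maximalAtlas
        (CP1.mem_maximalAtlas_real (hψ x))).mdifferentiableAt_symm hs
      exact h1.comp s (((hγ x).differentiable (by simp)) s).mdifferentiableAt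
  obtain ⟨q, hqV, hq⟩ := CP1.exists_mem_forall_notMem_image hβ hV hne
  refine ⟨q, hqV, ?_, fun z hz => hq none ⟨Complex.arg z, mem_univ _, ?_⟩⟩
  · rintro p rfl hp
    obtain ⟨x, hxC, hpx⟩ := mem_iUnion₂.1 (hcov ▸ mem_univ (⟨p, hp⟩ : criticalSet π))
    replace hpx : p ∈ (e x).source := hpx
    have h0 := plaqueCoord_eq_zero_of_mem_criticalSet hπ (he x).1
      (CP1.mem_maximalAtlas_real (hψ x)) (hmaps x) (hγ x) (heq x) hpx hp
    have h1 : γ x (e x p 2) = ψ x (π p) := by rw [heq x p hpx, h0]; simp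
    refine hq (some ⟨x, hxC⟩) ⟨e x p 2, ?_, ?_⟩
    · change γ x (e x p 2) ∈ (ψ x).target
      rw [h1]
      exact (ψ x).map_source (hmaps x hpx)
    · change (ψ x).symm (γ x (e x p 2)) = π p
      rw [h1, (ψ x).left_inv (hmaps x hpx)]
  · change π (gb (Circle.exp _)) = q
    rw [Circle.exp_arg, hz]

section Immersion

variable {u : ℂ → M} {x : ℂ} {s : Set ℂ}

/-- At a regular point, a leafwise immersion composed with the branched cover is an immersion. -/
theorem fderiv_comp_injective (hπ : IsFoliatedBranchedCover F π)
    (hu : MDifferentiableAt 𝓘(ℝ, ℂ) (𝓡 3) u x)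
    (himm : Function.Injective (mfderiv 𝓘(ℝ, ℂ) (𝓡 3) u x)) (hleaf : F.LeafContinuousOn u s)
    (hs : s ∈ 𝓝 x) (hreg : u x ∉ criticalSet π) {χ : OpenPartialHomeomorph CP1 ℂ}
    (hχ : χ ∈ IsManifold.maximalAtlas 𝓘(ℝ, ℂ) ∞ CP1) (hxχ : π (u x) ∈ χ.source) {v : ℂ}
    (hv : fderiv ℝ (fun y => χ (π (u y))) x v = 0) : v = 0 := by
  have hχd := mdifferentiable_of_mem_maximalAtlas hχ
  have hπd : MDifferentiableAt (𝓡 3) 𝓘(ℝ, ℂ) π (u x) := (hπ.smooth _).mdifferentiableAt (by simp)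
  have hc := mfderiv_comp x (hχd.mdifferentiableAt hxχ) (hπd.comp x hu)
  have hc' := mfderiv_comp x hπd hu
  rw [← mfderiv_eq_fderiv] at hv
  have h1 : mfderiv 𝓘(ℝ, ℂ) 𝓘(ℝ, ℂ) χ (π (u x)) (mfderiv 𝓘(ℝ, ℂ) 𝓘(ℝ, ℂ) (π ∘ u) x v) = 0 :=
    (DFunLike.congr_fun hc v).symm.trans hv
  have h2 := (injective_iff_map_eq_zero _).1 (hχd.mfderiv_injective hxχ) _ h1
  have h3 : mfderiv (𝓡 3) 𝓘(ℝ, ℂ) π (u x) (mfderiv 𝓘(ℝ, ℂ) (𝓡 3) u x v) = 0 :=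
    (DFunLike.congr_fun hc' v).symm.trans h2
  refine (injective_iff_map_eq_zero _).1 himm _ (hπ.leafwise_regular _ hreg _
    (mfderiv_mem_tangentPlane hu (fun e he hp => ?_) v) h3)
  have := hleaf.eventually_eq_chart he (mem_of_mem_nhds hs) hp
  rwa [nhdsWithin_eq_nhds.2 hs] at this

theorem _root_.nhds_le_map_add_sq (c z : ℂ) :
    𝓝 (c + z ^ 2) ≤ map (fun w : ℂ => c + w ^ 2) (𝓝 z) := by
  have hA : AnalyticAt ℂ (fun w : ℂ => c + w ^ 2) z := by fun_prop
  refine hA.eventually_constant_or_nhds_le_map_nhds.resolve_left fun h => ?_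
  refine infinite_of_mem_nhds z h ((toFinite {z, -z}).subset fun w hw => ?_)
  exact sq_eq_sq_iff_eq_or_eq_neg.1 (add_left_cancel hw)

/-- A leafwise immersion composed with the branched cover is an open map: at the critical points it
is a local homeomorphism followed by `w ↦ c + w ^ 2`. -/
theorem nhds_le_map_comp (hπ : IsFoliatedBranchedCover F π)
    (hu : ContMDiffAt 𝓘(ℝ, ℂ) (𝓡 3) ∞ u x)
    (himm : Function.Injective (mfderiv 𝓘(ℝ, ℂ) (𝓡 3) u x)) (hleaf : F.LeafContinuousOn u s)
    (hs : s ∈ 𝓝 x) : 𝓝 (π (u x)) ≤ map (fun y => π (u y)) (𝓝 x) := by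
  have hud : MDifferentiableAt 𝓘(ℝ, ℂ) (𝓡 3) u x := hu.mdifferentiableAt (by simp)
  have hcont : ContinuousAt (fun y => π (u y)) x :=
    (hπ.smooth.continuous.continuousAt).comp hu.continuousAt
  by_cases hcrit : u x ∈ criticalSet π
  · obtain ⟨e, ψ, hψ, γ, he, hxe, -, hmaps, hγ, heq⟩ : ∃ e : OpenPartialHomeomorph M E3,
        ∃ ψ ∈ IsManifold.maximalAtlas 𝓘(ℂ, ℂ) ω CP1, ∃ γ : ℝ → ℂ, F.IsFoliatedChart e ∧
        u x ∈ e.source ∧ e (u x) = 0 ∧ MapsTo π e.source ψ.source ∧ ContDiff ℝ ∞ γ ∧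
        ∀ p ∈ e.source, ψ (π p) = γ (e p 2) + plaqueCoord e p ^ 2 := hπ.local_model _ hcrit
    have hed := mdifferentiable_of_mem_maximalAtlas he.1
    have heu : ContDiffAt ℝ ∞ (fun y => E3.equivProd (e (u y))) x := by
      have h1 := (contMDiffAt_of_mem_maximalAtlas he.1 hxe).comp x hu
      exact E3.equivProd.contDiff.contDiffAt.comp x (contMDiffAt_iff_contDiffAt.1 h1)
    have hlev : ∀ᶠ y in 𝓝 x, e (u y) 2 = e (u x) 2 := by
      have := hleaf.eventually_eq he.isAdapted (mem_of_mem_nhds hs) hxe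
      rwa [nhdsWithin_eq_nhds.2 hs] at this
    have hDZ : ContDiffAt ℝ 1 (fun y => (E3.equivProd (e (u y))).1) x :=
      (contDiffAt_fst.comp x heu).of_le (by norm_cast)
    -- `u` is an immersion into a leaf, so its plaque coordinate is already an immersion
    have hinj : ∀ v, fderiv ℝ (fun y => (E3.equivProd (e (u y))).1) x v = 0 → v = 0 := by
      intro v hv
      have hd := (heu.differentiableAt (by simp)).hasFDerivAt
      have h2 : HasFDerivAt (fun y => (E3.equivProd (e (u y))).2) (0 : ℂ →L[ℝ] ℝ) x :=
        (hasFDerivAt_const (e (u x) 2) x).congr_of_eventuallyEq hlev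
      have h3 : fderiv ℝ (fun y => E3.equivProd (e (u y))) x v = 0 := by
        refine Prod.ext ?_ ?_
        · rw [hd.fst.fderiv] at hv
          exact hv
        · exact DFunLike.congr_fun (hd.snd.unique h2) v
      have h4 := mfderiv_comp x (hed.mdifferentiableAt hxe) hud
      have h5 : DifferentiableAt ℝ (e ∘ u) x := mdifferentiableAt_iff_differentiableAt.1
        ((hed.mdifferentiableAt hxe).comp x hud)
      have h6 : HasFDerivAt (fun y => E3.equivProd (e (u y)))
          ((E3.equivProd : E3 →L[ℝ] ℂ × ℝ).comp (fderiv ℝ (e ∘ u) x)) x :=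
        E3.equivProd.hasFDerivAt.comp x h5.hasFDerivAt
      rw [h6.fderiv] at h3
      have h7 : fderiv ℝ (e ∘ u) x v = 0 := E3.equivProd.map_eq_zero_iff.1 h3
      rw [← mfderiv_eq_fderiv, h4] at h7
      exact (injective_iff_map_eq_zero _).1 himm _
        ((injective_iff_map_eq_zero _).1 (hed.mfderiv_injective hxe) _ h7)
    obtain ⟨θ, hxθ, hθ⟩ := hDZ.exists_openPartialHomeomorph rfl hinj
    have hmap := θ.map_nhds_eq hxθ
    rw [hθ] at hmap
    refine ψ.nhds_le_map_of_comp hcont (hmaps hxe) ?_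
    have hev : (fun y => ψ (π (u y))) =ᶠ[𝓝 x]
        (fun w => γ (e (u x) 2) + w ^ 2) ∘ fun y => (E3.equivProd (e (u y))).1 := by
      filter_upwards [hlev, hu.continuousAt.eventually (e.open_source.mem_nhds hxe)] with y hy hye
      rw [heq _ hye, hy]
      rfl
    have hx0 : ψ (π (u x)) = γ (e (u x) 2) + (E3.equivProd (e (u x))).1 ^ 2 := hev.self_of_nhds
    rw [map_congr hev, ← map_map, hmap, hx0]
    exact nhds_le_map_add_sq _ _
  · let χ := chartAt ℂ (π (u x))
    have hχs : π (u x) ∈ χ.source := mem_chart_source ℂ _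
    have hχ : χ ∈ IsManifold.maximalAtlas 𝓘(ℝ, ℂ) ∞ CP1 := IsManifold.chart_mem_maximalAtlas _
    have hsm := (contMDiffAt_of_mem_maximalAtlas hχ hχs).comp x ((hπ.smooth _).comp x hu)
    obtain ⟨θ, hxθ, hθ⟩ := ((contMDiffAt_iff_contDiffAt.1 hsm).of_le (m := 1)
      (by norm_cast)).exists_openPartialHomeomorph rfl fun v hv =>
        fderiv_comp_injective hπ hud himm hleaf hs hcrit hχ hχs hv
    have hmap := θ.map_nhds_eq hxθ
    rw [hθ] at hmap
    exact χ.nhds_le_map_of_comp hcont hχs hmap.ge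

end Immersion

/-- In a family of leafwise immersions, the preimages of a regular value of the branched cover are
locally graphs over the parameter. -/
theorem exists_local_graph (hπ : IsFoliatedBranchedCover F π) {g : ℝ → ℂ → M} {t : ℝ} {x : ℂ}
    {s : Set ℂ} (hg : ContMDiffAt 𝓘(ℝ, ℝ × ℂ) (𝓡 3) ∞ (fun y : ℝ × ℂ => g y.1 y.2) (t, x))
    (himm : Function.Injective (mfderiv 𝓘(ℝ, ℂ) (𝓡 3) (g t) x)) (hleaf : F.LeafContinuousOn (g t) s)
    (hs : s ∈ 𝓝 x) (hreg : g t x ∉ criticalSet π) :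
    (∃ U ∈ 𝓝 x, ∀ᶠ s in 𝓝 t, ∀ a ∈ U, ∀ b ∈ U, π (g s a) = π (g t x) → π (g s b) = π (g t x) →
      a = b) ∧ ∀ U ∈ 𝓝 x, ∀ᶠ s in 𝓝 t, ∃ a ∈ U, π (g s a) = π (g t x) := by
  let χ := chartAt ℂ (π (g t x))
  have hχs : π (g t x) ∈ χ.source := mem_chart_source ℂ _
  have hχ : χ ∈ IsManifold.maximalAtlas 𝓘(ℝ, ℂ) ∞ CP1 := IsManifold.chart_mem_maximalAtlas _
  have hgt : MDifferentiableAt 𝓘(ℝ, ℂ) (𝓡 3) (g t) x := by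
    have h1 : DifferentiableAt ℝ (fun y : ℂ => (t, y)) x := by fun_prop
    exact MDifferentiableAt.comp x (f := fun y : ℂ => (t, y)) (g := fun y : ℝ × ℂ => g y.1 y.2)
      (hg.mdifferentiableAt (by simp)) h1.mdifferentiableAt
  let f : ℝ × ℂ → ℂ := fun y => χ (π (g y.1 y.2))
  have hf : ContDiffAt ℝ ∞ f (t, x) := contMDiffAt_iff_contDiffAt.1
    ((contMDiffAt_of_mem_maximalAtlas hχ hχs).comp (t, x) ((hπ.smooth _).comp (t, x) hg))
  have hfd : HasFDerivAt f (fderiv ℝ f (t, x)) (t, x) := (hf.differentiableAt (by simp)).hasFDerivAt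
  have hΘ : ContDiffAt ℝ 1 (fun y : ℝ × ℂ => (y.1, f y)) (t, x) :=
    contDiffAt_fst.prodMk (hf.of_le (by norm_cast))
  -- the inverse function theorem is applied to `(t, x) ↦ (t, f (t, x))`
  have hinj : ∀ v, fderiv ℝ (fun y : ℝ × ℂ => (y.1, f y)) (t, x) v = 0 → v = 0 := by
    rintro ⟨τ, v⟩ hv
    rw [(hasFDerivAt_fst.prodMk hfd).fderiv] at hv
    obtain ⟨hτ, hv⟩ := Prod.ext_iff.1 hv
    obtain rfl : τ = 0 := hτ
    have h1 : HasFDerivAt (fun y : ℂ => f (t, y))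
        ((fderiv ℝ f (t, x)).comp (ContinuousLinearMap.inr ℝ ℝ ℂ)) x :=
      hfd.comp x (hasFDerivAt_prodMk_right t x)
    have h2 : fderiv ℝ (fun y : ℂ => χ (π (g t y))) x v = 0 := by
      change fderiv ℝ (fun y : ℂ => f (t, y)) x v = 0
      rw [h1.fderiv]
      exact hv
    rw [fderiv_comp_injective hπ hgt himm hleaf hs hreg hχ hχs h2]
    rfl
  obtain ⟨θ, hxθ, hθ⟩ := hΘ.exists_openPartialHomeomorph rfl hinj
  have hsrc : ∀ᶠ y : ℝ × ℂ in 𝓝 (t, x), y ∈ θ.source ∧ π (g y.1 y.2) ∈ χ.source :=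
    (θ.open_source.eventually_mem hxθ).and
      (((hπ.smooth.continuous.continuousAt).comp hg.continuousAt).eventually
        (χ.open_source.mem_nhds hχs))
  constructor
  · rw [nhds_prod_eq] at hsrc
    obtain ⟨P, hP, Q, hQ, hPQ⟩ := eventually_prod_iff.1 hsrc
    refine ⟨{y | Q y}, hQ, ?_⟩
    filter_upwards [hP] with τ hτ a ha b hb hpa hpb
    have h := θ.injOn (hPQ hτ ha).1 (hPQ hτ hb).1 (by
      rw [hθ]
      change (τ, χ (π (g τ a))) = (τ, χ (π (g τ b)))
      rw [hpa, hpb])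
    exact (Prod.ext_iff.1 h).2
  · intro U hU
    have hθx : θ (t, x) = (t, χ (π (g t x))) := by rw [hθ]
    have hsymm : Tendsto (fun τ : ℝ => θ.symm (τ, χ (π (g t x)))) (𝓝 t) (𝓝 (t, x)) := by
      have h1 := θ.continuousAt_symm (θ.map_source hxθ)
      rw [hθx] at h1
      have h2 : Tendsto (fun τ : ℝ => (τ, χ (π (g t x)))) (𝓝 t) (𝓝 (t, χ (π (g t x)))) :=
        (Continuous.prodMk_left _).tendsto t
      have h3 := Tendsto.comp h1 h2
      rw [← hθx, θ.left_inv hxθ] at h3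
      exact h3
    have htgt : ∀ᶠ τ : ℝ in 𝓝 t, (τ, χ (π (g t x))) ∈ θ.target := by
      have h2 : Tendsto (fun τ : ℝ => (τ, χ (π (g t x)))) (𝓝 t) (𝓝 (t, χ (π (g t x)))) :=
        (Continuous.prodMk_left _).tendsto t
      exact h2.eventually (θ.open_target.mem_nhds (hθx ▸ θ.map_source hxθ))
    filter_upwards [htgt, hsymm.eventually hsrc,
      hsymm.eventually (continuousAt_snd.preimage_mem_nhds hU)] with τ h1 h2 h3
    have h4 := θ.right_inv h1
    rw [hθ] at h4
    obtain ⟨h5, h6⟩ := Prod.ext_iff.1 h4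
    have h5' : (θ.symm (τ, χ (π (g t x)))).1 = τ := h5
    refine ⟨_, h3, ?_⟩
    have h7 := χ.injOn h2.2 hχs h6
    rwa [h5'] at h7

end CodimOneFoliation

end

/-! ### Families of leafwise disks -/

theorem Convex.locallyConnectedSpace {E : Type*} [NormedAddCommGroup E] [NormedSpace ℝ E] {s : Set E}
    (hs : Convex ℝ s) : LocallyConnectedSpace s := by
  refine locallyConnectedSpace_of_connected_bases (fun x ε => ball x ε) (fun _ ε => 0 < ε)
    (fun x => nhds_basis_ball) fun x ε _ => ?_
  rw [← IsInducing.subtypeVal.isPreconnected_image]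
  have h : Subtype.val '' ball x ε = s ∩ ball (x : E) ε := by
    ext y
    constructor
    · rintro ⟨y, hy, rfl⟩
      exact ⟨y.2, hy⟩
    · rintro ⟨hys, hy⟩
      exact ⟨⟨y, hys⟩, hy, rfl⟩
  rw [h]
  exact (hs.inter (convex_ball _ _)).isPreconnected

section TendstoC0

variable {X M : Type*} [TopologicalSpace M] [CompactSpace M] [T2Space M] {f : ℝ → X → M} {f₀ : X → M}

theorem TendstoC0.eventually_mem (h : TendstoC0 f f₀) {O : Set (M × M)}
    (hO : O ∈ 𝓝ˢ (diagonal M)) : ∀ᶠ t in 𝓝[>] (0 : ℝ), ∀ x, (f₀ x, f t x) ∈ O := h O hO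

theorem TendstoC0.eventually_forall_mem (h : TendstoC0 f f₀) {W : Set M} (hW : IsOpen W)
    (hf₀ : IsClosed (range f₀)) (hsub : range f₀ ⊆ W) : ∀ᶠ t in 𝓝[>] (0 : ℝ), ∀ x, f t x ∈ W := by
  have hO : IsOpen ((range f₀)ᶜ ×ˢ (univ : Set M) ∪ univ ×ˢ W) :=
    (hf₀.isOpen_compl.prod isOpen_univ).union (isOpen_univ.prod hW)
  have hd : diagonal M ⊆ (range f₀)ᶜ ×ˢ (univ : Set M) ∪ univ ×ˢ W := by
    rintro ⟨p, q⟩ (rfl : p = q)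
    by_cases hp : p ∈ range f₀
    · exact Or.inr ⟨mem_univ _, hsub hp⟩
    · exact Or.inl ⟨hp, mem_univ _⟩
  filter_upwards [h.eventually_mem (hO.mem_nhdsSet.2 hd)] with t ht x
  rcases ht x with hx | hx
  · exact absurd (mem_range_self x) hx.1
  · exact hx.2

end TendstoC0

section

variable {M : Type*} [TopologicalSpace M] [ChartedSpace E3 M]
  {F : CodimOneFoliation M} {π : M → CP1} {g : ℝ → ℂ → M}

open CodimOneFoliation

namespace IsTransverseDiskFamily

theorem continuousOn (hg : IsTransverseDiskFamily F g) {t : ℝ} (ht : t ∈ Ioc (0 : ℝ) 1) :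
    ContinuousOn (g t) (closedBall 0 1) :=
  ContinuousOn.comp (g := fun y : ℝ × ℂ => g y.1 y.2) hg.smooth.continuousOn
    (Continuous.prodMk_right t).continuousOn fun _ hx => ⟨ht, hx⟩

theorem leafContinuousOn [SecondCountableTopology M] (hg : IsTransverseDiskFamily F g) {t : ℝ}
    (ht : t ∈ Ioc (0 : ℝ) 1) : F.LeafContinuousOn (g t) (closedBall 0 1) := by
  obtain ⟨L, hL, hgL⟩ := hg.leafwise t ht
  have := (convex_closedBall (0 : ℂ) 1).locallyConnectedSpace
  have h := hL.leafContinuousOn (f := fun x : closedBall (0 : ℂ) 1 => g t x)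
    (continuousOn_iff_continuous_domRestrict.1 (hg.continuousOn ht)) fun x => hgL x.2
  exact (@continuousOn_iff_continuous_domRestrict ℂ M _ F.leafTopology _ _).2
    ((@continuousOn_univ _ M _ F.leafTopology _).1 h)

theorem contMDiffAt (hg : IsTransverseDiskFamily F g) {t : ℝ} (ht : t ∈ Ioo (0 : ℝ) 1) {x : ℂ}
    (hx : ‖x‖ < 1) : ContMDiffAt 𝓘(ℝ, ℝ × ℂ) (𝓡 3) ∞ (fun y : ℝ × ℂ => g y.1 y.2) (t, x) :=
  hg.smooth.contMDiffAt (prod_mem_nhds (Ioc_mem_nhds ht.1 ht.2)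
    (closedBall_mem_nhds_of_mem (mem_ball_zero_iff.2 hx)))

theorem contMDiffAt_apply (hg : IsTransverseDiskFamily F g) {t : ℝ} (ht : t ∈ Ioo (0 : ℝ) 1) {x : ℂ}
    (hx : ‖x‖ < 1) : ContMDiffAt 𝓘(ℝ, ℂ) (𝓡 3) ∞ (g t) x := by
  have h1 : ContDiffAt ℝ ∞ (fun y : ℂ => (t, y)) x := by fun_prop
  exact ContMDiffAt.comp x (f := fun y : ℂ => (t, y)) (g := fun y : ℝ × ℂ => g y.1 y.2)
    (hg.contMDiffAt ht hx) h1.contMDiffAt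

theorem injective_mfderiv (hg : IsTransverseDiskFamily F g) {t : ℝ} (ht : t ∈ Ioo (0 : ℝ) 1) {x : ℂ}
    (hx : ‖x‖ < 1) : Function.Injective (mfderiv 𝓘(ℝ, ℂ) (𝓡 3) (g t) x) := by
  have h := hg.immersion t ⟨ht.1, ht.2.le⟩ x (mem_closedBall_zero_iff.2 hx.le)
  rwa [mfderivWithin_of_mem_nhds (closedBall_mem_nhds_of_mem (mem_ball_zero_iff.2 hx))] at h

variable [IsManifold (𝓡 3) ∞ M] [SecondCountableTopology M]

/-- The number of preimages of a regular value in the disks does not depend on the parameter as long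
as no preimage meets the boundary. -/
theorem exists_ncard_preimage (hg : IsTransverseDiskFamily F g)
    (hπ : IsFoliatedBranchedCover F π) {q : CP1} (hq : ∀ p, π p = q → p ∉ criticalSet π) {t₀ : ℝ}
    (ht₀ : t₀ ∈ Ioo (0 : ℝ) 1) (hbd : ∀ t ∈ Ioo (0 : ℝ) t₀, ∀ x : ℂ, ‖x‖ = 1 → π (g t x) ≠ q) :
    ∃ N : ℕ, ∀ t ∈ Ioo (0 : ℝ) t₀, {x : closedBall (0 : ℂ) 1 | π (g t x) = q}.Finite ∧
      {x : closedBall (0 : ℂ) 1 | π (g t x) = q}.ncard = N := by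
  have hsub : ∀ t ∈ Ioo (0 : ℝ) t₀, t ∈ Ioo (0 : ℝ) 1 := fun t ht => ⟨ht.1, ht.2.trans ht₀.2⟩
  have := (isPreconnected_iff_preconnectedSpace.1 (isPreconnected_Ioo (a := (0 : ℝ)) (b := t₀)))
  have : CompactSpace (closedBall (0 : ℂ) 1) := isCompact_iff_compactSpace.1 (isCompact_closedBall _ _)
  let Z : Set (Ioo (0 : ℝ) t₀ × closedBall (0 : ℂ) 1) := {y | π (g y.1 y.2) = q}
  have hZ : IsClosed Z := by
    have hc : Continuous fun y : Ioo (0 : ℝ) t₀ × closedBall (0 : ℂ) 1 => g y.1 y.2 :=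
      hg.smooth.continuousOn.comp_continuous
        (f := fun y : Ioo (0 : ℝ) t₀ × closedBall (0 : ℂ) 1 => ((y.1 : ℝ), (y.2 : ℂ)))
        (by fun_prop) fun y => ⟨⟨(hsub _ y.1.2).1, (hsub _ y.1.2).2.le⟩, y.2.2⟩
    exact isClosed_eq (hπ.smooth.continuous.comp hc) continuous_const
  have hint : ∀ z ∈ Z, ‖(z.2 : ℂ)‖ < 1 := fun z hz =>
    (mem_closedBall_zero_iff.1 z.2.2).lt_of_ne fun h => hbd z.1 z.1.2 _ h hz
  have hgraph : ∀ z ∈ Z, (∃ U ∈ 𝓝 (z.2 : ℂ), ∀ᶠ s in 𝓝 (z.1 : ℝ), ∀ a ∈ U, ∀ b ∈ U,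
      π (g s a) = q → π (g s b) = q → a = b) ∧
      ∀ U ∈ 𝓝 (z.2 : ℂ), ∀ᶠ s in 𝓝 (z.1 : ℝ), ∃ a ∈ U, π (g s a) = q := by
    rintro ⟨t, x⟩ (rfl : π (g t x) = q)
    have hx := hint (t, x) rfl
    have ht := hsub t t.2
    exact exists_local_graph hπ (hg.contMDiffAt ht hx) (hg.injective_mfderiv ht hx)
      (hg.leafContinuousOn ⟨ht.1, ht.2.le⟩) (closedBall_mem_nhds_of_mem (mem_ball_zero_iff.2 hx))
      (hq _ rfl)
  have huniq : ∀ z ∈ Z, ∃ U ∈ 𝓝 z.2, ∀ᶠ s in 𝓝 z.1, ∀ a ∈ U, ∀ b ∈ U,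
      (s, a) ∈ Z → (s, b) ∈ Z → a = b := fun z hz => by
    obtain ⟨U, hU, h⟩ := (hgraph z hz).1
    refine ⟨_, continuousAt_subtype_val.preimage_mem_nhds hU, ?_⟩
    filter_upwards [continuousAt_subtype_val.eventually h] with s hs a ha b hb hsa hsb
    exact Subtype.ext (hs a ha b hb hsa hsb)
  have hex : ∀ z ∈ Z, ∀ U ∈ 𝓝 z.2, ∀ᶠ s in 𝓝 z.1, ∃ a ∈ U, (s, a) ∈ Z := fun z hz U hU => by
    obtain ⟨U', hU', hUU'⟩ :=
      mem_nhdsWithin_iff_exists_mem_nhds_inter.1 (mem_nhds_subtype_iff_nhdsWithin.1 hU)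
    have hb : ball (0 : ℂ) 1 ∈ 𝓝 (z.2 : ℂ) := isOpen_ball.mem_nhds (mem_ball_zero_iff.2 (hint z hz))
    filter_upwards [continuousAt_subtype_val.eventually ((hgraph z hz).2 _ (inter_mem hU' hb))]
      with s hs
    obtain ⟨a, ⟨haU, hab⟩, ha⟩ := hs
    refine ⟨⟨a, ball_subset_closedBall hab⟩, ?_, ha⟩
    obtain ⟨y, hy, hya⟩ := hUU' ⟨haU, ball_subset_closedBall hab⟩
    rwa [show (⟨a, ball_subset_closedBall hab⟩ : closedBall (0 : ℂ) 1) = y from Subtype.ext hya.symm]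
  have hmid : t₀ / 2 ∈ Ioo (0 : ℝ) t₀ := ⟨half_pos ht₀.1, half_lt_self ht₀.1⟩
  refine ⟨{x : closedBall (0 : ℂ) 1 | π (g (t₀ / 2) x) = q}.ncard, fun t ht =>
    ⟨finite_fibre hZ huniq ⟨t, ht⟩, ?_⟩⟩
  exact (isLocallyConstant_ncard_fibre hZ huniq hex).apply_eq_of_preconnectedSpace ⟨t, ht⟩
    ⟨t₀ / 2, hmid⟩

variable [CompactSpace M] [T2Space M]

/-- Near the limit, the disks lie within a bounded number of plaques of their boundaries. -/
theorem exists_eventually_mem_iterate_plaqueNhd (hg : IsTransverseDiskFamily F g)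
    (hπ : IsFoliatedBranchedCover F π) {gb : Circle → M} (hgb : ContMDiff (𝓡 1) (𝓡 3) ∞ gb)
    (hlim : TendstoC0 (fun t (z : Circle) => g t z) gb) {ι : Type*} [Finite ι] (B : ι → F.FlowBox)
    {r : ι → ℝ} (hr0 : ∀ i, 0 ≤ r i) (hr : ∀ i, r i < (B i).radius)
    (hcov : ∀ p, ∃ i, p ∈ (B i).cell (r i)) {ψ : ι → OpenPartialHomeomorph CP1 ℂ} {γ : ι → ℝ → ℂ}
    {m : ι → ℕ} (hB : ∀ i, (B i).IsStraightened π (ψ i) (γ i) (m i)) :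
    ∃ n, ∀ᶠ t in 𝓝[>] (0 : ℝ), ∀ x ∈ closedBall (0 : ℂ) 1,
      g t x ∈ (plaqueNhd B)^[n] (range fun z : Circle => g t z) := by
  have hπc := hπ.smooth.continuous
  have : CompactSpace (closedBall (0 : ℂ) 1) := isCompact_iff_compactSpace.1 (isCompact_closedBall _ _)
  have := (convex_closedBall (0 : ℂ) 1).locallyConnectedSpace
  have : PreconnectedSpace (closedBall (0 : ℂ) 1) :=
    isPreconnected_iff_preconnectedSpace.1 (convex_closedBall _ _).isPreconnected
  choose V hVo hVy hVc hVB using exists_isOpen_forall_plaqueRel hπc B hr0 hr hcov hB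
  obtain ⟨κ, hκ⟩ := (isCompact_range hπc).elim_finite_subcover V hVo fun y _ =>
    mem_iUnion.2 ⟨y, hVy y⟩
  have hVcov : ∀ p, ∃ k : κ, π p ∈ V k := fun p => by
    obtain ⟨k, hk, hpk⟩ := mem_iUnion₂.1 (hκ (mem_range_self p))
    exact ⟨⟨k, hk⟩, hpk⟩
  choose q hqV hqreg hqgb using fun k : κ =>
    exists_mem_notMem_criticalValues hπ hgb (hVo k) (hVc k).nonempty
  -- for small parameters, the marked values are not attained on the boundary
  have hbd : ∀ᶠ t in 𝓝[>] (0 : ℝ), ∀ k, ∀ z : Circle, π (g t z) ≠ q k := by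
    refine eventually_all.2 fun k => ?_
    refine hlim.eventually_forall_mem (W := π ⁻¹' {q k}ᶜ) (isOpen_compl_singleton.preimage hπc)
      (isCompact_range hgb.continuous).isClosed ?_
    rintro _ ⟨z, rfl⟩
    exact hqgb k z
  obtain ⟨t₁, ht₁, hbd⟩ := mem_nhdsGT_iff_exists_Ioo_subset.1 hbd
  let t₀ := min t₁ (1 / 2)
  have ht₀ : t₀ ∈ Ioo (0 : ℝ) 1 := ⟨lt_min ht₁ (by norm_num), (min_le_right _ _).trans_lt (by norm_num)⟩
  have hnorm : ∀ t ∈ Ioo (0 : ℝ) t₀, ∀ k, ∀ x : ℂ, ‖x‖ = 1 → π (g t x) ≠ q k := fun t ht k x hx =>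
    hbd ⟨ht.1, ht.2.trans_le (min_le_left _ _)⟩ k ⟨x, mem_sphere_zero_iff_norm.2 hx⟩
  choose N hN using fun k => hg.exists_ncard_preimage hπ (hqreg k) ht₀ fun t ht => hnorm t ht k
  refine ⟨∑ k, N k + 1, ?_⟩
  filter_upwards [Ioo_mem_nhdsGT ht₀.1] with t ht
  have ht' : t ∈ Ioo (0 : ℝ) 1 := ⟨ht.1, ht.2.trans ht₀.2⟩
  have hleaf := hg.leafContinuousOn (t := t) ⟨ht'.1, ht'.2.le⟩
  have hleafX := hleaf.domRestrict
  let f : closedBall (0 : ℂ) 1 → CP1 := fun x => π (g t x)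
  let A : Set (closedBall (0 : ℂ) 1) := {x | ‖(x : ℂ)‖ = 1}
  have hf : Continuous f := hπc.comp (continuousOn_univ.1 hleafX.continuousOn)
  have hopen : ∀ x ∉ A, 𝓝 (f x) ≤ map f (𝓝 x) := fun x hx => by
    have hx1 : ‖(x : ℂ)‖ < 1 := (mem_closedBall_zero_iff.1 x.2).lt_of_ne hx
    have hnh : closedBall (0 : ℂ) 1 ∈ 𝓝 (x : ℂ) :=
      closedBall_mem_nhds_of_mem (mem_ball_zero_iff.2 hx1)
    have h := nhds_le_map_comp hπ (hg.contMDiffAt_apply ht' hx1) (hg.injective_mfderiv ht' hx1)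
      hleaf hnh
    rw [← map_nhds_subtype_coe_eq_nhds x.2 hnh, map_map] at h
    exact h
  have huniv := iterate_pieceNhd_eq_univ (κ := κ) (V := fun k => V k) hf (fun k => hVo k)
    (fun k => (hVc k).isPreconnected) (fun x => hVcov _) hqV (A := A)
    ⟨⟨1, by simp⟩, by simp [A]⟩ hopen (fun k => (hN k t ht).1)
    (N := ∑ k, N k) (Finset.sum_le_sum fun k _ => (hN k t ht).2.le)
  have hpiece : ∀ S : Set (closedBall (0 : ℂ) 1), (fun x : closedBall (0 : ℂ) 1 => g t x) ''
      pieceNhd f (fun k : κ => V k) S ⊆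
      plaqueNhd B ((fun x : closedBall (0 : ℂ) 1 => g t x) '' S) := by
    rintro S _ ⟨y, ⟨k, hk, x, hxS, hx⟩, rfl⟩
    obtain ⟨i, hi⟩ := hVB k _ _ _ isPreconnected_connectedComponentIn
      (hleafX.mono (subset_univ _)) (connectedComponentIn_subset _ _) x hx y
      (mem_connectedComponentIn hk)
    exact Or.inr ⟨i, g t x, mem_image_of_mem _ hxS, hi⟩
  have hiter : ∀ n, (fun x : closedBall (0 : ℂ) 1 => g t x) ''
      (pieceNhd f (fun k : κ => V k))^[n] A ⊆ (plaqueNhd B)^[n] (range fun z : Circle => g t z) := by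
    intro n
    induction n with
    | zero =>
      rintro _ ⟨x, hx, rfl⟩
      exact ⟨⟨x, mem_sphere_zero_iff_norm.2 hx⟩, rfl⟩
    | succ n ih =>
      rw [Function.iterate_succ_apply', Function.iterate_succ_apply']
      exact (hpiece _).trans (plaqueNhd_mono B ih)
  intro x hx
  exact hiter _ ⟨⟨x, hx⟩, huniv ▸ mem_univ _, rfl⟩

end IsTransverseDiskFamily

/-- Finitely many straightened flow boxes whose smaller cells cover the manifold. -/
theorem IsFoliatedBranchedCover.exists_finite_flowBoxes [IsManifold (𝓡 3) ∞ M] [CompactSpace M]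
    (hπ : IsFoliatedBranchedCover F π) : ∃ (ι : Finset M) (B : ι → F.FlowBox)
      (ψ : ι → OpenPartialHomeomorph CP1 ℂ) (γ : ι → ℝ → ℂ) (m : ι → ℕ),
      (∀ i, (B i).IsStraightened π (ψ i) (γ i) (m i)) ∧
      ∀ p, ∃ i, p ∈ (B i).cell ((B i).radius / 2) := by
  choose B ψ γ m hB hmem using fun p => exists_flowBox_isStraightened hπ p
  obtain ⟨s, -, hs⟩ := isCompact_univ.elim_nhds_subcover _ fun p _ => hmem p
  refine ⟨s, fun i => B i, fun i => ψ i, fun i => γ i, fun i => m i, fun i => hB i,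
    fun p => ?_⟩
  obtain ⟨i, hi, hp⟩ := mem_iUnion₂.1 (hs (mem_univ p))
  exact ⟨⟨i, hi⟩, hp⟩

end

theorem proposition3p2 {M : Type*} [TopologicalSpace M] [ChartedSpace E3 M]
    [IsManifold (𝓡 3) ∞ M] [CompactSpace M] [T2Space M] (hM : IsOrientable3 M)
    (F : CodimOneFoliation M) (hF : F.IsCoorientable)
    (π : M → CP1) (hπ : IsFoliatedBranchedCover F π)
    (g : ℝ → ℂ → M) (hg : IsTransverseDiskFamily F g)
    (gb : Circle → M) (hgb : ContMDiff (𝓡 1) (𝓡 3) ∞ gb)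
    (hgb_imm : ∀ z, Function.Injective (mfderiv (𝓡 1) (𝓡 3) gb z))
    (L : Set M) (hL : F.IsLeaf L) (hgbL : ∀ z, gb z ∈ L)
    (hlim : TendstoC0 (fun t (z : Circle) => g t z) gb) :
    ∃ h : ℂ → M, @ContinuousOn ℂ M _ F.leafTopology h (closedBall 0 1) ∧
      MapsTo h (closedBall 0 1) L ∧ ∀ z : Circle, h z = gb z := by
  classical
  have : SecondCountableTopology M := ChartedSpace.secondCountable_of_sigmaCompact E3 M
  have : LocallyConnectedSpace Circle := ChartedSpace.locallyConnectedSpace (EuclideanSpace ℝ (Fin 1)) _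
  have hgbleaf := (@continuousOn_univ _ M _ F.leafTopology _).1
    (hL.leafContinuousOn hgb.continuous hgbL)
  obtain ⟨ι, B, ψ, γ, m, hB, hcov⟩ := hπ.exists_finite_flowBoxes
  have hr0 : ∀ i, 0 ≤ (B i).radius / 2 := fun i => (half_pos (B i).radius_pos).le
  have hr : ∀ i, (B i).radius / 2 < (B i).radius := fun i => half_lt_self (B i).radius_pos
  obtain ⟨n, hn⟩ := hg.exists_eventually_mem_iterate_plaqueNhd hπ hgb hlim B hr0 hr hcov hB
  -- the limit of the disks lies in a leaf-compact set
  let K : Set M := (CodimOneFoliation.plaqueNhd B)^[n] (range gb)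
  have hK : F.IsLeafCompact K := CodimOneFoliation.IsLeafCompact.iterate_plaqueNhd B
    (@isCompact_range _ M _ F.leafTopology _ _ hgbleaf) n
  have hgbK : range gb ⊆ K := by
    have : ∀ k, range gb ⊆ (CodimOneFoliation.plaqueNhd B)^[k] (range gb) := by
      intro k
      induction k with
      | zero => exact subset_rfl
      | succ k ih =>
        rw [Function.iterate_succ_apply']
        exact ih.trans (CodimOneFoliation.subset_plaqueNhd B _)
    exact this n
  obtain ⟨O, hO, hext⟩ := CodimOneFoliation.exists_leafContinuousOn_extension
    (X := closedBall (0 : ℂ) 1) B hr hcov (hK.plaqueNhd B)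
    (CodimOneFoliation.subset_plaqueNhd B K) fun i x hx hxK => Or.inr ⟨i, x.1, hxK, hx⟩
  obtain ⟨O₁, hO₁, hdO₁, hO₁O⟩ := mem_nhdsSet_iff_exists.1 hO
  have hKopen : IsOpen (⋃ p ∈ K, {a | (a, p) ∈ O₁}) :=
    isOpen_biUnion fun p _ => hO₁.preimage (Continuous.prodMk_left p)
  obtain ⟨W, hW, hgbW, hWK⟩ := CodimOneFoliation.exists_isOpen_iterate_plaqueNhd_subset B n
    (K := range gb) hKopen fun p hp => mem_iUnion₂.2 ⟨p, hp, hdO₁ rfl⟩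
  have hev1 := hlim.eventually_forall_mem hW (isCompact_range hgb.continuous).isClosed hgbW
  have hev2 := hlim.eventually_mem (O := Prod.swap ⁻¹' O₁)
    ((hO₁.preimage continuous_swap).mem_nhdsSet.2 fun x hx => by
      obtain ⟨p, q⟩ := x
      obtain rfl : p = q := hx
      exact hdO₁ rfl)
  obtain ⟨t, htn, ht1, ht2, ht⟩ :=
    (hn.and (hev1.and (hev2.and (Ioo_mem_nhdsGT (zero_lt_one (α := ℝ)))))).exists
  have hgt := (hg.leafContinuousOn ⟨ht.1, ht.2.le⟩).domRestrict
  let A : Set (closedBall (0 : ℂ) 1) := {x | ‖(x : ℂ)‖ = 1}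
  let b : closedBall (0 : ℂ) 1 → M := fun x =>
    if hx : ‖(x : ℂ)‖ = 1 then gb ⟨x, mem_sphere_zero_iff_norm.2 hx⟩ else gb 1
  have hbA : ∀ (x : closedBall (0 : ℂ) 1) (hx : ‖(x : ℂ)‖ = 1), b x = gb ⟨x, mem_sphere_zero_iff_norm.2 hx⟩ :=
    fun x hx => dif_pos hx
  have hA : IsClosed A := isClosed_eq (continuous_subtype_val.norm) continuous_const
  have hbleaf : F.LeafContinuousOn b A := by
    refine (@continuousOn_iff_continuous_domRestrict _ M _ F.leafTopology _ _).2 ?_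
    have heq : A.domRestrict b = fun x : A => gb ⟨(x : closedBall (0 : ℂ) 1),
      mem_sphere_zero_iff_norm.2 x.2⟩ := funext fun x => hbA x x.2
    rw [heq]
    exact @Continuous.comp _ _ M _ _ F.leafTopology _ _ hgbleaf
      ((continuous_subtype_val.comp continuous_subtype_val).subtype_mk _)
  obtain ⟨h, hh, hhb⟩ := hext _ b A hgt
    (fun x => by
      obtain ⟨p, hp, hxp⟩ := mem_iUnion₂.1 (hWK ((CodimOneFoliation.plaqueNhd_mono B).iterate n
        (range_subset_iff.2 ht1) (htn x x.2)))
      exact ⟨p, hp, hO₁O hxp⟩) hA hbleaf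
    (fun x hx => by
      rw [hbA x hx]
      exact CodimOneFoliation.subset_plaqueNhd B K (hgbK (mem_range_self _)))
    (fun x hx => by
      rw [hbA x hx]
      exact hO₁O (ht2 ⟨x, mem_sphere_zero_iff_norm.2 hx⟩))
  have hhc := (@continuousOn_univ _ M _ F.leafTopology _).1 hh
  have hz : ∀ z : Circle, (z : ℂ) ∈ closedBall (0 : ℂ) 1 := fun z =>
    mem_closedBall_zero_iff.2 z.norm_coe.le
  have hhgb : ∀ z : Circle, h ⟨z, hz z⟩ = gb z := fun z =>
    (hhb (x := ⟨z, hz z⟩) z.norm_coe).trans (hbA _ z.norm_coe)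
  -- the value outside the disk is irrelevant
  let h' : ℂ → M := fun x => if hx : x ∈ closedBall (0 : ℂ) 1 then h ⟨x, hx⟩ else gb 1
  have hh' : ∀ x (hx : x ∈ closedBall (0 : ℂ) 1), h' x = h ⟨x, hx⟩ := fun x hx => dif_pos hx
  refine ⟨h', ?_, fun x hx => ?_, fun z => (hh' z (hz z)).trans (hhgb z)⟩
  · refine (@continuousOn_iff_continuous_domRestrict _ M _ F.leafTopology _ _).2 ?_
    have heq : (closedBall (0 : ℂ) 1).domRestrict h' = h := funext fun x => hh' x x.2
    rwa [heq]
  · rw [hh' x hx]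
    have : PathConnectedSpace (closedBall (0 : ℂ) 1) := isPathConnected_iff_pathConnectedSpace.1
      ((convex_closedBall _ _).isPathConnected ⟨x, hx⟩)
    obtain ⟨p, rfl⟩ := hL
    have h1 : @Joined M F.leafTopology p (gb 1) := hgbL 1
    have h2 : Joined (⟨1, by simp⟩ : closedBall (0 : ℂ) 1) ⟨x, hx⟩ := PathConnectedSpace.joined _ _
    have h3 := @Joined.map _ M _ F.leafTopology _ _ _ h2 hhc
    have h4 : h ⟨1, by simp⟩ = gb 1 := hhgb 1
    rw [h4] at h3
    exact @Joined.trans M F.leafTopology _ _ _ h1 h3
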